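/- **Setting.** Let $G=(V,E)$ be a simple graph. Its 1-complex, also denoted $G$, has point set $V\sqcup\mathring E$ ($\mathring E$ the set of inner edge points). A *representation* $\mathbb M_E/{\sim}$ of $G$ is given by choosing for every edge $e\in E$ which of its two ends is glued to $0_e$ and which to $1_e$, where $\mathbb M_E=\bigoplus_{e\in E}\mathbb I_e$ is the topological sum of copies $\mathbb I_e$ of $[0,1]$; the 1-complex carries the corresponding quotient topology (isolated vertices being isolated points). Let $\beta G$ be the Stone–Čech compactification of the 1-complex, $G^*=\beta G\setminus G$ its remainder, and write $p\mapsto[p]_{\sim_\beta}$ for the canonical map $\beta\mathbb M_E\to\beta G$ extending the quotient map $\mathbb M_E\to G$. For an ultrafilter $U$ on $E$ let $\mathbb I_U=\bigcap_{J\in U}\overline{\bigcup_{e\in J}\mathbb I_e}\subseteq\beta\mathbb M_E$, let $0_U,1_U$ be the limits of $(0_e)_{e\in E}$ and $(1_e)_{e\in E}$ along $U$ in $\beta\mathbb M_E$, and let $\check{\mathbb I}_U=\mathbb I_U\setminus\{0_U,1_U\}$. A (finite-order) separation is a set $\{A,B\}$ with $A\cup B=V$, $A\cap B$ finite, and no edge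 between $A\setminus B$ and $B\setminus A$; its orientations are $(A,B)$ and $(B,A)$, and $(A,B)\le(C,D)$ means $A\subseteq C$ and $B\supseteq D$. An *$\aleph_0$-tangle* is a set $\tau$ of oriented separations that contains precisely one orientation of each separation, contains no two distinct $(B,A),(C,D)$ with $(A,B)<(C,D)$, and does not include any finite star of finite interior; here a star is a set $\sigma$ of oriented separations such that $(A,B)\le(C,D)$ for any two distinct $(A,B),(D,C)\in\sigma$, and its interior is $\bigcap_{(A,B)\in\sigma}B$. For finite $X\subseteq V$ and a set $\mathcal C$ of components of $G-X$ let $V[\mathcal C]$ be the union of their vertex sets, and let $U(\tau,X)$ be the ultrafilter of all $\mathcal C$ with $(V\setminus V[\mathcal C],\,X\cup V[\mathcal C])\in\tau$. Call $\tau$ an *ultrafilter tangle* if $U(\tau,X)$ is free for some finite $X$; then there is a least such $X$, denoted $X_\tau$. An *end* $\omega$ is a class of rays, two rays being equivalent if for every finite $X\subseteq V$ they have tails in the same component of $G-X$; let $C(X,\omega)$ be the component of $G-X$ in which every ray of $\omega$ has a tail. Its end tangle is $\tau_\omega=\{(A,B): C(A\cap B,\omega)\subseteq G[B\setminus A]\}$,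 with $(A,B)$ ranging over the oriented separations. A vertex $v$ *dominates* $\omega$ if for some ray $R\in\omega$ there are infinitely many $v$–$(R-v)$ paths that pairwise meet only in $v$; $\Delta\omega$ is the set of vertices dominating $\omega$. For an $\aleph_0$-tangle $\tau$ there is exactly one connected component of $G^*$ that lies in $\overline{G[X\cup V[\mathcal C]]}^{\beta G}$ for all finite $X\subseteq V$ and all $\mathcal C\in U(\tau,X)$; it is denoted $\tau_*$, and $\omega_*:=(\tau_\omega)_*$ for an end $\omega$. **Proposition 7.3.** Let $G$ be any simple graph and let $\mathbb M_E/{\sim}$ be a representation of $G$. 1. If $\tau$ is an ultrafilter tangle of $G$ (so that $\tau_*$ and $X_\tau$ exist and are unique), then $\overline{\tau_*}^{\beta G}=\tau_*\sqcup X_\tau$, and for each $x\in X_\tau$ there is a free ultrafilter $U$ on $E$ such that $[0_U]_{\sim_\beta}=x$ or $[1_U]_{\sim_\beta}=x$, and such that the image of $\check{\mathbb I}_U$ in $\beta G$ is included in $\tau_*$. 2. If $\omega$ is an end of $G$ (so that $\omega_*$ exists and is unique), then $\overline{\omega_*}^{\beta G}=\omega_*\sqcup\Delta\omega$, and for each $x\in\Delta\omega$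 there is a free ultrafilter $U$ on $E$ such that $[0_U]_{\sim_\beta}=x$ or $[1_U]_{\sim_\beta}=x$, and such that the image of $\check{\mathbb I}_U$ in $\beta G$ is included in $\omega_*$. -/

import Mathlib

namespace TangleSC

universe u

variable {V : Type u}

/-! # Finite-order separations, tangles and the ultrafilters they induce -/

/-- `(A, B)` is an oriented separation of finite order: `A ∪ B = V`, `A ∩ B` is finite and `G` has
no edge between `A \ B` and `B \ A`. The small side is `A`, the big side is `B`. -/
def IsSeparation (G : SimpleGraph V) (s : Set V × Set V) : Prop :=
  s.1 ∪ s.2 = Set.univ ∧ (s.1 ∩ s.2).Finite ∧ ∀ a ∈ s.1 \ s.2, ∀ b ∈ s.2 \ s.1, ¬ G.Adj a b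

/-- `(A, B) ≤ (C, D)` iff `A ⊆ C` and `B ⊇ D`. -/
def SepLE (s t : Set V × Set V) : Prop := s.1 ⊆ t.1 ∧ t.2 ⊆ s.2

/-- `O` consists of finite-order separations and contains precisely one of `(A, B)`, `(B, A)` for
every finite-order separation `{A, B}`. -/
def IsOrientation (G : SimpleGraph V) (O : Set (Set V × Set V)) : Prop :=
  (∀ s ∈ O, IsSeparation G s) ∧
  (∀ s, IsSeparation G s → s ∈ O ∨ s.swap ∈ O) ∧
  (∀ s, s ∈ O → s.swap ∈ O → s = s.swap)

/-- No two distinct separations `(B, A)`, `(C, D)` in `O` satisfy `(A, B) < (C, D)`. -/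
def IsConsistent (O : Set (Set V × Set V)) : Prop :=
  ∀ s ∈ O, ∀ t ∈ O, s ≠ t → ¬ (SepLE s.swap t ∧ s.swap ≠ t)

/-- Any two distinct members `(A, B)`, `(D, C)` of `σ` satisfy `(A, B) ≤ (C, D)`. -/
def IsStar (σ : Set (Set V × Set V)) : Prop :=
  ∀ s ∈ σ, ∀ t ∈ σ, s ≠ t → SepLE s t.swap

/-- The intersection of the big sides. -/
def starInterior (σ : Set (Set V × Set V)) : Set V := ⋂ s ∈ σ, s.2

/-- An `ℵ₀`-tangle: a consistent orientation of the finite-order separations that contains no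
finite star of finite interior. -/
def IsTangle (G : SimpleGraph V) (τ : Set (Set V × Set V)) : Prop :=
  IsOrientation G τ ∧ IsConsistent τ ∧
    ∀ σ ⊆ τ, σ.Finite → IsStar σ → ¬ (starInterior σ).Finite

/-- `V[𝒞]`, the set of the vertices of the components in `𝒞`; here `𝒞` is a set of components of
`G - X`. -/
def compVerts (G : SimpleGraph V) {X : Set V} (𝒞 : Set (G.ComponentCompl X)) : Set V :=
  ⋃ C ∈ 𝒞, C.supp

/-- The separation `(V \ V[𝒞], X ∪ V[𝒞])`, which points towards `𝒞`. -/
def sepTowards (G : SimpleGraph V) {X : Set V} (𝒞 : Set (G.ComponentCompl X)) : Set V × Set V :=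
  ((compVerts G 𝒞)ᶜ, X ∪ compVerts G 𝒞)

/-- `U(τ, X)`: the collection of those sets `𝒞` of components of `G - X` towards which `τ`
orients the separation defined by `X` and `𝒞`. -/
def tangleUltra (G : SimpleGraph V) (τ : Set (Set V × Set V)) (X : Finset V) :
    Set (Set (G.ComponentCompl (X : Set V))) :=
  {𝒞 | sepTowards G 𝒞 ∈ τ}

/-- The collection of the finite `X ⊆ V` for which the ultrafilter `U(τ, X)` is free, i.e. not
generated by a single component of `G - X`. -/
def freeSets (G : SimpleGraph V) (τ : Set (Set V × Set V)) : Set (Finset V) :=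
  {X | ∀ C : G.ComponentCompl (X : Set V), {C} ∉ tangleUltra G τ X}

/-- An ultrafilter tangle: a tangle for which at least one of the `U(τ, X)` is free. -/
def IsUltrafilterTangle (G : SimpleGraph V) (τ : Set (Set V × Set V)) : Prop :=
  IsTangle G τ ∧ (freeSets G τ).Nonempty

/-! # Rays, ends, end tangles, domination -/

/-- A ray: a one-way infinite path. -/
structure Ray (G : SimpleGraph V) where
  vert : ℕ → V
  inj : Function.Injective vert
  adj : ∀ n, G.Adj (vert n) (vert (n + 1))

/-- The ray `R` has a tail in the vertex set `S`. -/
def HasTailIn {G : SimpleGraph V} (R : Ray G) (S : Set V) : Prop :=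
  ∃ N, ∀ n ≥ N, R.vert n ∈ S

/-- Two rays are equivalent if for every finite `X` they have tails in the same component of
`G - X`. -/
def RayEquiv {G : SimpleGraph V} (R S : Ray G) : Prop :=
  ∀ X : Set V, X.Finite → ∃ C : G.ComponentCompl X, HasTailIn R C.supp ∧ HasTailIn S C.supp

theorem exists_comp_hasTail {G : SimpleGraph V} (R : Ray G) {X : Set V} (hX : X.Finite) :
    ∃ C : G.ComponentCompl X, HasTailIn R C.supp := by
  have hfin : {n | R.vert n ∈ X}.Finite := hX.preimage R.inj.injOn
  obtain ⟨N, hN⟩ := hfin.bddAbove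
  have hout : ∀ n ≥ N + 1, R.vert n ∉ X := by
    intro n hn h
    have := hN h
    omega
  refine ⟨G.componentComplMk (hout (N + 1) le_rfl), N + 1, ?_⟩
  intro n hn
  induction n, hn using Nat.le_induction with
  | base => exact SimpleGraph.componentComplMk_mem G _
  | succ n hn ih =>
    exact SimpleGraph.ComponentCompl.mem_of_adj _ _ ih (hout _ (by omega)) (R.adj n)

theorem rayEquiv_equivalence (G : SimpleGraph V) : Equivalence (RayEquiv (G := G)) where
  refl R X hX := by
    obtain ⟨C, hC⟩ := exists_comp_hasTail R hX
    exact ⟨C, hC, hC⟩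
  symm h X hX := by
    obtain ⟨C, h1, h2⟩ := h X hX
    exact ⟨C, h2, h1⟩
  trans {R S T} h h' X hX := by
    obtain ⟨C, h1, n, h2⟩ := h X hX
    obtain ⟨D, ⟨m, h3⟩, h4⟩ := h' X hX
    have hCD : C = D := by
      by_contra hne
      exact Set.disjoint_left.1 (SimpleGraph.ComponentCompl.pairwise_disjoint hne)
        (h2 (max n m) (le_max_left _ _)) (h3 (max n m) (le_max_right _ _))
    subst hCD
    exact ⟨C, h1, h4⟩

instance raySetoid (G : SimpleGraph V) : Setoid (Ray G) := ⟨RayEquiv, rayEquiv_equivalence G⟩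

/-- The (combinatorial) ends of `G`: equivalence classes of rays. -/
def GraphEnd (G : SimpleGraph V) : Type u := Quotient (raySetoid G)

/-- `R` is one of the rays of the end `ω`. -/
def Ray.Mem {G : SimpleGraph V} (R : Ray G) (ω : GraphEnd G) : Prop :=
  Quotient.mk (raySetoid G) R = ω

/-- `C = C(X, ω)`: every ray of `ω` has a tail in the component `C` of `G - X`. -/
def IsEndComponent {G : SimpleGraph V} (ω : GraphEnd G) {X : Set V} (C : G.ComponentCompl X) :
    Prop :=
  ∀ R : Ray G, R.Mem ω → HasTailIn R C.supp

/-- The end tangle `τ_ω`: the set of the finite-order separations `(A, B)` for which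
`C(A ∩ B, ω) ⊆ G[B \ A]`. -/
def endTangle {G : SimpleGraph V} (ω : GraphEnd G) : Set (Set V × Set V) :=
  {s | IsSeparation G s ∧
    ∃ C : G.ComponentCompl (s.1 ∩ s.2), IsEndComponent ω C ∧ C.supp ⊆ s.2 \ s.1}

/-- The vertex `v` dominates the ray `R`: there are infinitely many `v`–`(R - v)` paths in `G`
that pairwise meet only in `v`. -/
def DominatesRay {G : SimpleGraph V} (v : V) (R : Ray G) : Prop :=
  ∃ (w : ℕ → V) (p : ∀ i, G.Walk v (w i)),
    (∀ i, (p i).IsPath) ∧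
    (∀ i, w i ∈ Set.range R.vert ∧ w i ≠ v) ∧
    (∀ i, ∀ x ∈ (p i).support, x ∈ Set.range R.vert → x = v ∨ x = w i) ∧
    (∀ i j, i ≠ j → ∀ x, x ∈ (p i).support → x ∈ (p j).support → x = v)

/-- `Δω`: the set of the vertices that dominate a ray of `ω`. -/
def dominatingVerts {G : SimpleGraph V} (ω : GraphEnd G) : Set V :=
  {v | ∃ R : Ray G, R.Mem ω ∧ DominatesRay v R}

/-! # The 1-complex as a quotient of a disjoint sum of unit intervals -/

/-- A choice, for every edge, of which of its two ends is glued to `0` and which to `1`. This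
determines a representation of the 1-complex as a quotient of a disjoint sum of intervals. -/
structure Representation (G : SimpleGraph V) where
  src : G.edgeSet → V
  tgt : G.edgeSet → V
  edge_eq : ∀ e : G.edgeSet, s(src e, tgt e) = (e : Sym2 V)

/-- `𝕄_E`: the topological sum of copies of the unit interval, one for every edge. -/
abbrev EdgeSum (G : SimpleGraph V) : Type u := Σ _ : G.edgeSet, unitInterval

/-- The points of the 1-complex: the vertices and the inner edge points. The point
`inner e t` is the point `t` of the edge `e`, parametrised from `r.src e` to `r.tgt e`. -/
inductive OneComplex {G : SimpleGraph V} (r : Representation G) : Type u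
  | vertex (v : V) : OneComplex r
  | inner (e : G.edgeSet) (t : Set.Ioo (0 : ℝ) 1) : OneComplex r

open Classical in
/-- The quotient map `𝕄_E → 𝕄_E/∼ = G`. -/
noncomputable def glue {G : SimpleGraph V} (r : Representation G) (x : EdgeSum G) :
    OneComplex r :=
  if h0 : x.2 = 0 then .vertex (r.src x.1)
  else if h1 : x.2 = 1 then .vertex (r.tgt x.1)
  else .inner x.1 ⟨x.2, unitInterval.pos_iff_ne_zero.2 h0, unitInterval.lt_one_iff_ne_one.2 h1⟩

/-- The quotient topology: a set is open iff it meets every edge in an open set. (An isolated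
vertex is an isolated point.) -/
noncomputable instance oneComplexTopology {G : SimpleGraph V} (r : Representation G) :
    TopologicalSpace (OneComplex r) :=
  TopologicalSpace.coinduced (glue r) inferInstance

theorem continuous_glue {G : SimpleGraph V} (r : Representation G) : Continuous (glue r) :=
  continuous_coinduced_rng

/-- The 1-complex of the induced subgraph `G[W]`, as a subset of the 1-complex of `G`. -/
def inducedComplex {G : SimpleGraph V} (r : Representation G) (W : Set V) :
    Set (OneComplex r) :=
  {p | match p with
    | .vertex v => v ∈ W
    | .inner e _ => r.src e ∈ W ∧ r.tgt e ∈ W}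

/-! # Stone–Čech compactifications -/

/-- A vertex, as a point of `βG`. -/
noncomputable def vertexPt {G : SimpleGraph V} (r : Representation G) (v : V) : StoneCech (OneComplex r) :=
  stoneCechUnit (OneComplex.vertex v)

/-- The Stone–Čech remainder `G^* = βG \ G`. -/
def remainder {G : SimpleGraph V} (r : Representation G) : Set (StoneCech (OneComplex r)) :=
  (Set.range stoneCechUnit)ᶜ

/-- The canonical map `β𝕄_E → βG`, `p ↦ [p]_{∼β}`: the extension of the quotient map. -/
noncomputable def betaGlue {G : SimpleGraph V} (r : Representation G) :
    StoneCech (EdgeSum G) → StoneCech (OneComplex r) :=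
  stoneCechExtend (g := stoneCechUnit ∘ glue r)
    (continuous_stoneCechUnit.comp (continuous_glue r))

/-- The point `t_U` of `β𝕄_E`: the limit along `U` of the family of the points `t_e`. -/
noncomputable def limitPt {G : SimpleGraph V} (U : Ultrafilter G.edgeSet) (t : unitInterval) :
    StoneCech (EdgeSum G) :=
  (U.map fun e => stoneCechUnit (⟨e, t⟩ : EdgeSum G)).lim

/-- The interval `𝕀_U`: the intersection, over all `J ∈ U`, of the closures in `β𝕄_E` of the
union of the intervals `𝕀_e` with `e ∈ J`. -/
def limitInterval {G : SimpleGraph V} (U : Ultrafilter G.edgeSet) : Set (StoneCech (EdgeSum G)) :=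
  ⋂ J ∈ U, closure (stoneCechUnit '' {x : EdgeSum G | x.1 ∈ J})

/-- The interior of `𝕀_U`: the interval without its endpoints `0_U` and `1_U`. -/
def limitInterior {G : SimpleGraph V} (U : Ultrafilter G.edgeSet) : Set (StoneCech (EdgeSum G)) :=
  limitInterval U \ {limitPt U 0, limitPt U 1}

/-- `K` is a connected component of the remainder `G^*` that corresponds to `τ`: for all finite `X`
and all `𝒞 ∈ U(τ, X)` it lies in the closure of `G[X ∪ V[𝒞]]`. -/
def IsTangleComponent {G : SimpleGraph V} (r : Representation G) (τ : Set (Set V × Set V))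
    (K : Set (StoneCech (OneComplex r))) : Prop :=
  (∃ z ∈ remainder r, K = connectedComponentIn (remainder r) z) ∧
  ∀ X : Finset V, ∀ 𝒞 ∈ tangleUltra G τ X,
    K ⊆ closure (stoneCechUnit '' inducedComplex r ((X : Set V) ∪ compVerts G 𝒞))

/-- The vertex `x` is, in `βG`, the image of an endpoint of some interval `𝕀_U` with `U` a free
ultrafilter on the edge set, and the interior of `𝕀_U` is mapped into `K`. -/
def IsReachedFrom {G : SimpleGraph V} (r : Representation G)
    (K : Set (StoneCech (OneComplex r))) (x : V) : Prop :=
  ∃ U : Ultrafilter G.edgeSet, (∀ e, U ≠ pure e) ∧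
    (betaGlue r (limitPt U 0) = vertexPt r x ∨ betaGlue r (limitPt U 1) = vertexPt r x) ∧
    betaGlue r '' limitInterior U ⊆ K

end TangleSC

namespace TangleSC

universe u

variable {V : Type u}

/-! # Tangles as directed families of big sides -/

/-! Everything is read off from one set: `tangleRemainder r τ`, the points of the remainder that lie
in the closure of `G[B]` for every `(A, B) ∈ τ`. It is shown to be the component `τ_*`, and its
closure is shown to add exactly the vertices in `tangleCore τ`, the intersection of all big sides.

No component of the remainder leaves this set, because the closures of the two sides of a separation
meet only inside `G` (`closure_inter_closure_subset`). The set is also connected. Any two of its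
points avoid a common system of stars around all the vertices, with radii depending on vertex and
edge. What remains outside the stars is a directed intersection of compact sets `starCore`. By
compactness, a splitting of `starCore` would already split the part of some `G[B]` off finitely many
stars. Edges off the stars are intervals, so this splits the vertices of `B`, up to a finite set,
into two classes with no edge between them. The tangle chooses one class, so `starCore` lies on one
side.

An inner edge point is never a limit of the remainder, since edges are compact, and a vertex in the
closure lies in every big side. Conversely, a core vertex has infinitely many neighbours in every
big side. A free ultrafilter `U` on the corresponding edges gives an interval with an end mapped to
that vertex and its interior mapped into `τ_*`. As the ends of `𝕀_U` are limits of its interior, the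
vertex lies in the closure.

It remains to identify the core: it is `X_τ` for an ultrafilter tangle
(`IsUltrafilterTangle.exists_least`) and `Δω` for an end tangle (`core_endTangle`). -/

theorem IsSeparation.swap {G : SimpleGraph V} {s : Set V × Set V} (h : IsSeparation G s) :
    IsSeparation G s.swap := by
  obtain ⟨h1, h2, h3⟩ := h
  refine ⟨by rw [Prod.fst_swap, Prod.snd_swap, Set.union_comm]; exact h1,
    by rw [Prod.fst_swap, Prod.snd_swap, Set.inter_comm]; exact h2, ?_⟩
  intro a ha b hb hab
  exact h3 b hb a ha hab.symm

theorem IsSeparation.mem_or {G : SimpleGraph V} {s : Set V × Set V} (h : IsSeparation G s)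
    (v : V) : v ∈ s.1 ∨ v ∈ s.2 := by
  have : v ∈ s.1 ∪ s.2 := h.1 ▸ Set.mem_univ v
  exact this

theorem IsSeparation.both_mem_or {G : SimpleGraph V} {s : Set V × Set V} (h : IsSeparation G s)
    {v w : V} (hvw : G.Adj v w) : (v ∈ s.1 ∧ w ∈ s.1) ∨ (v ∈ s.2 ∧ w ∈ s.2) := by
  have h1 := h.mem_or v
  have h2 := h.mem_or w
  have h3 := h.2.2 v
  have h4 := h.2.2 w
  have h5 := hvw.symm
  by_contra hc
  simp only [Set.mem_sdiff] at h3 h4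
  grind

theorem IsSeparation.join {G : SimpleGraph V} {s t : Set V × Set V} (hs : IsSeparation G s)
    (ht : IsSeparation G t) : IsSeparation G (s.1 ∪ t.1, s.2 ∩ t.2) := by
  refine ⟨?_, (hs.2.1.union ht.2.1).subset ?_, ?_⟩
  · ext v
    have h1 := hs.mem_or v
    have h2 := ht.mem_or v
    simp only [Set.mem_union, Set.mem_inter_iff, Set.mem_univ, iff_true]
    tauto
  · intro v hv
    simp only [Set.mem_union, Set.mem_inter_iff] at hv ⊢
    tauto
  · intro a ha b hb hab
    have h1 := hs.both_mem_or hab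
    have h2 := ht.both_mem_or hab
    simp only [Set.mem_sdiff, Set.mem_union, Set.mem_inter_iff] at ha hb
    tauto

section Tangle

variable {G : SimpleGraph V} {τ : Set (Set V × Set V)}

theorem IsTangle.isSeparation (hτ : IsTangle G τ) {s : Set V × Set V} (hs : s ∈ τ) :
    IsSeparation G s := hτ.1.1 s hs

theorem IsTangle.infinite_snd (hτ : IsTangle G τ) {s : Set V × Set V} (hs : s ∈ τ) :
    s.2.Infinite := by
  have h := hτ.2.2 {s} (by simpa using hs) (Set.finite_singleton s)
    (by rintro a rfl b rfl hab; exact absurd rfl hab)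
  simpa [starInterior] using h

theorem IsTangle.mem_of_sepLE (hτ : IsTangle G τ) {s t : Set V × Set V} (hs : s ∈ τ)
    (ht : IsSeparation G t) (hts : SepLE t s) : t ∈ τ := by
  by_contra hn
  have hsw : t.swap ∈ τ := (hτ.1.2.1 t ht).resolve_left hn
  have hne : t ≠ s := fun h => hn (h ▸ hs)
  by_cases hst : t.swap = s
  · subst hst
    refine hτ.infinite_snd hs (ht.2.1.subset ?_)
    exact fun v hv => ⟨hv, hts.1 hv⟩
  · exact hτ.2.1 _ hsw s hs hst ⟨by simpa using hts, by simpa using hne⟩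

/-- Two separations in a tangle have their join in the tangle. -/
theorem IsTangle.join_mem (hτ : IsTangle G τ) {s t : Set V × Set V} (hs : s ∈ τ) (ht : t ∈ τ) :
    (s.1 ∪ t.1, s.2 ∩ t.2) ∈ τ := by
  have hs' := hτ.isSeparation hs
  have ht' := hτ.isSeparation ht
  have hj := hs'.join ht'
  by_contra hn
  have h1 : (s.2 ∩ t.2, s.1 ∪ t.1) ∈ τ := (hτ.1.2.1 _ hj).resolve_left hn
  -- The three separations with small sides `s.1`, `s.2 ∩ t.1` and `s.2 ∩ t.2` form a star whose
  -- interior lies in the union of the two finite separators.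
  have h2 : (s.2 ∩ t.1, s.1 ∪ t.2) ∈ τ :=
    hτ.mem_of_sepLE ht (hs'.join ht'.swap).swap
      ⟨Set.inter_subset_right, Set.subset_union_right⟩
  refine hτ.2.2 {s, (s.2 ∩ t.1, s.1 ∪ t.2), (s.2 ∩ t.2, s.1 ∪ t.1)} ?_ (by simp) ?_ ?_
  · rintro a (rfl | rfl | rfl) <;> assumption
  · rintro a (rfl | rfl | rfl) b (rfl | rfl | rfl) hab <;>
    first
    | exact absurd rfl hab
    | (constructor <;> intro v <;> simp only [Prod.fst_swap, Prod.snd_swap, Set.mem_inter_iff,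
        Set.mem_union] <;> tauto)
  · refine (hs'.2.1.union ht'.2.1).subset ?_
    intro v hv
    simp only [starInterior, Set.mem_iInter, Set.mem_insert_iff, Set.mem_singleton_iff,
      forall_eq_or_imp, forall_eq] at hv
    simp only [Set.mem_union, Set.mem_inter_iff] at hv ⊢
    tauto

theorem IsTangle.nonempty (hτ : IsTangle G τ) : τ.Nonempty := by
  have h : IsSeparation G ((∅ : Set V), (Set.univ : Set V)) := by
    refine ⟨by simp, by simp, by simp⟩
  rcases hτ.1.2.1 _ h with h | h
  exacts [⟨_, h⟩, ⟨_, h⟩]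

/-- Finitely many separations in a tangle have a common upper bound in the tangle. -/
theorem IsTangle.exists_le_of_finite (hτ : IsTangle G τ) {F : Set (Set V × Set V)}
    (hF : F.Finite) (hFτ : F ⊆ τ) : ∃ s ∈ τ, ∀ t ∈ F, SepLE t s := by
  induction F, hF using Set.Finite.induction_on with
  | empty =>
    obtain ⟨s, hs⟩ := hτ.nonempty
    exact ⟨s, hs, by simp⟩
  | @insert a F _ _ ih =>
    obtain ⟨s, hs, h⟩ := ih ((Set.subset_insert _ _).trans hFτ)
    refine ⟨_, hτ.join_mem hs (hFτ (Set.mem_insert a F)), ?_⟩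
    rintro t (rfl | ht)
    · exact ⟨Set.subset_union_right, Set.inter_subset_right⟩
    · exact ⟨(h t ht).1.trans Set.subset_union_left, Set.inter_subset_left.trans (h t ht).2⟩

/-- If `s` points towards `B₁ ∪ B₂` and no edge joins `B₁` to `B₂`, then the tangle points towards
one of the two parts. -/
theorem IsTangle.exists_mem_of_cover (hτ : IsTangle G τ) {s : Set V × Set V} (hs : s ∈ τ)
    {Y B₁ B₂ : Set V} (hY : Y.Finite) (hsY : s.1 ∩ s.2 ⊆ Y) (hB : s.2 ⊆ Y ∪ B₁ ∪ B₂)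
    (h₂ : B₂ ⊆ s.2) (hdis : Disjoint B₁ B₂)
    (hadj : ∀ a ∈ B₁, ∀ b ∈ B₂, ¬ G.Adj a b) :
    ∃ t ∈ τ, t.2 ⊆ s.2 ∧ (t.2 ⊆ Y ∪ B₁ ∨ t.2 ⊆ Y ∪ B₂) := by
  have hs' := hτ.isSeparation hs
  have hd := Set.disjoint_left.1 hdis
  -- Whichever way the tangle orients this separation, the join with `s` has its big side in `Y ∪
  -- B₂` or in `Y ∪ B₁`; the latter uses `s.1 ∩ s.2 ⊆ Y`.
  have hsep : IsSeparation G (s.1 ∪ Y ∪ B₁, Y ∪ B₂) := by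
    refine ⟨?_, hY.subset ?_, ?_⟩
    · ext v
      have h1 := hs'.mem_or v
      have h2 := @hB v
      simp only [Set.mem_union, Set.mem_univ, iff_true] at h2 ⊢
      tauto
    · intro v hv
      have h2 := @hsY v
      have h3 := @h₂ v
      have h4 := @hd v
      simp only [Set.mem_union, Set.mem_inter_iff] at h2 hv
      tauto
    · intro a ha b hb hab
      have hbA : b ∉ s.1 := fun h => hb.2 (Or.inl (Or.inl h))
      have haB : a ∈ s.2 := ((hs'.both_mem_or hab).resolve_left fun h => hbA h.2).1
      have hb₂ : b ∈ B₂ := hb.1.resolve_left fun h => hb.2 (Or.inl (Or.inr h))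
      rcases hB haB with (h | h) | h
      · exact ha.2 (Or.inl h)
      · exact hadj a h b hb₂ hab
      · exact ha.2 (Or.inr h)
  rcases hτ.1.2.1 _ hsep with h | h
  · refine ⟨_, hτ.join_mem hs h, Set.inter_subset_left, Or.inr Set.inter_subset_right⟩
  · refine ⟨_, hτ.join_mem hs h, Set.inter_subset_left, Or.inl ?_⟩
    intro v hv
    have h2 := @hsY v
    simp only [Prod.snd_swap, Set.mem_union, Set.mem_inter_iff] at h2 hv ⊢
    tauto

/-- The vertices that cannot be separated from the tangle. -/
def tangleCore (τ : Set (Set V × Set V)) : Set V := ⋂ s ∈ τ, s.2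

theorem mem_tangleCore {x : V} : x ∈ tangleCore τ ↔ ∀ s ∈ τ, x ∈ s.2 := by
  simp [tangleCore]

/-- With only finitely many neighbours in `s.2`, the vertex `x` could be moved to the small side by
adding them to the separator. Pointing to `s.2 \ {x}` contradicts `x` being in the core; the other
orientation, joined with `s`, has a finite big side. -/
theorem IsTangle.infinite_neighbors (hτ : IsTangle G τ) {x : V} (hx : x ∈ tangleCore τ)
    {s : Set V × Set V} (hs : s ∈ τ) : (G.neighborSet x ∩ s.2).Infinite := by
  intro hfin
  have hs' := hτ.isSeparation hs
  have hsep : IsSeparation G (s.1 ∪ {x} ∪ (G.neighborSet x ∩ s.2), s.2 \ {x}) := by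
    refine ⟨?_, (hs'.2.1.union hfin).subset ?_, ?_⟩
    · ext v
      have h1 := hs'.mem_or v
      simp only [Set.mem_union, Set.mem_sdiff, Set.mem_singleton_iff, Set.mem_univ, iff_true]
      tauto
    · intro v hv
      simp only [Set.mem_union, Set.mem_sdiff, Set.mem_singleton_iff, Set.mem_inter_iff] at hv ⊢
      tauto
    · intro a ha b hb hab
      have h1 := hs'.both_mem_or hab
      have h2 : a = x → G.Adj x b := fun h => h ▸ hab
      simp only [Set.mem_union, Set.mem_sdiff, Set.mem_singleton_iff, Set.mem_inter_iff,
        SimpleGraph.mem_neighborSet] at ha hb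
      tauto
  rcases hτ.1.2.1 _ hsep with h | h
  · exact (mem_tangleCore.1 hx _ h).2 rfl
  · refine hτ.infinite_snd (hτ.join_mem hs h)
      ((hs'.2.1.union (hfin.union (Set.finite_singleton x))).subset ?_)
    intro v hv
    simp only [Prod.snd_swap, Set.mem_union, Set.mem_singleton_iff, Set.mem_inter_iff] at hv ⊢
    tauto

end Tangle

/-! # Components and separations -/

section Components

variable {G : SimpleGraph V}

theorem supp_subset_of_closed {X : Set V} (C : G.ComponentCompl X) {S : Set V}
    (hS : ∀ a ∈ S, ∀ b ∉ X, G.Adj a b → b ∈ S) {v : V} (hvC : v ∈ C.supp) (hv : v ∈ S) :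
    C.supp ⊆ S := by
  rintro w ⟨hw, hwC⟩
  obtain ⟨hvX, hvC⟩ := hvC
  have hr : (G.induce Xᶜ).Reachable ⟨v, hvX⟩ ⟨w, hw⟩ :=
    SimpleGraph.ConnectedComponent.eq.1 (hvC.trans hwC.symm)
  obtain ⟨p⟩ := hr
  have key : ∀ (a b : ↥(Xᶜ : Set V)), (G.induce Xᶜ).Walk a b → a.1 ∈ S → b.1 ∈ S := by
    intro a b p
    induction p with
    | nil => exact id
    | @cons a b c h p ih => exact fun ha => ih (hS _ ha _ b.2 (by simpa using h))
  exact key _ _ p hv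

theorem notMem_of_mem_supp {X : Set V} {C : G.ComponentCompl X} {v : V} (h : v ∈ C.supp) :
    v ∉ X := h.1

theorem mem_supp_of_adj {X : Set V} {C : G.ComponentCompl X} {v w : V} (hv : v ∈ C.supp)
    (hw : w ∉ X) (h : G.Adj v w) : w ∈ C.supp :=
  SimpleGraph.ComponentCompl.mem_of_adj v w hv hw h

theorem component_eq_of_mem {X : Set V} {C D : G.ComponentCompl X} {v : V} (h : v ∈ C.supp)
    (h' : v ∈ D.supp) : C = D := by
  by_contra hne
  exact Set.disjoint_left.1 (SimpleGraph.ComponentCompl.pairwise_disjoint hne) h h'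

theorem mem_compVerts {X : Set V} {𝒞 : Set (G.ComponentCompl X)} {v : V} :
    v ∈ compVerts G 𝒞 ↔ ∃ C ∈ 𝒞, v ∈ C.supp := by
  simp [compVerts]

theorem isSeparation_sepTowards {X : Set V} (hX : X.Finite) (𝒞 : Set (G.ComponentCompl X)) :
    IsSeparation G (sepTowards G 𝒞) := by
  refine ⟨?_, hX.subset ?_, ?_⟩
  · ext v
    simp only [sepTowards, Set.mem_union, Set.mem_compl_iff, Set.mem_univ, iff_true]
    tauto
  · intro v hv
    simp only [sepTowards, Set.mem_union, Set.mem_inter_iff, Set.mem_compl_iff] at hv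
    tauto
  · intro a ha b hb hab
    simp only [sepTowards, Set.mem_union, Set.mem_sdiff, Set.mem_compl_iff, not_or,
      not_not] at ha hb
    obtain ⟨C, hC, hbC⟩ := mem_compVerts.1 hb.2
    exact ha.1 (mem_compVerts.2 ⟨C, hC, mem_supp_of_adj hbC ha.2.1 hab.symm⟩)

theorem IsSeparation.diff_closed {s : Set V × Set V} (hs : IsSeparation G s) :
    ∀ a ∈ s.2 \ s.1, ∀ b ∉ s.1 ∩ s.2, G.Adj a b → b ∈ s.2 \ s.1 := by
  intro a ha b hb hab
  have h1 := hs.both_mem_or hab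
  simp only [Set.mem_sdiff, Set.mem_inter_iff] at ha hb ⊢
  tauto

theorem IsSeparation.supp_subset {s : Set V × Set V} (hs : IsSeparation G s)
    (C : G.ComponentCompl (s.1 ∩ s.2)) {v : V} (hvC : v ∈ C.supp) (hv : v ∈ s.2 \ s.1) :
    C.supp ⊆ s.2 \ s.1 :=
  supp_subset_of_closed C hs.diff_closed hvC hv

/-- The components inside `s.2 \ s.1` make up all of it. Hence ranging over all pairs `X`, `𝒞`
amounts to ranging over all finite-order separations. -/
theorem IsSeparation.exists_sepTowards_eq {s : Set V × Set V} (hs : IsSeparation G s)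
    {X : Set V} (hX : X = s.1 ∩ s.2) : ∃ 𝒞 : Set (G.ComponentCompl X), sepTowards G 𝒞 = s := by
  subst hX
  have hc : compVerts G {C : G.ComponentCompl (s.1 ∩ s.2) | C.supp ⊆ s.2 \ s.1} = s.2 \ s.1 := by
    ext v
    rw [mem_compVerts]
    constructor
    · rintro ⟨C, hC, hv⟩
      exact hC hv
    · intro hv
      have hvX : v ∉ s.1 ∩ s.2 := fun h => hv.2 h.1
      have hm := SimpleGraph.componentComplMk_mem G hvX
      exact ⟨_, hs.supp_subset _ hm hv, hm⟩
  refine ⟨{C : G.ComponentCompl (s.1 ∩ s.2) | C.supp ⊆ s.2 \ s.1}, Prod.ext ?_ ?_⟩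
  · simp only [sepTowards, hc]
    ext v
    have := hs.mem_or v
    simp only [Set.mem_compl_iff, Set.mem_sdiff]
    tauto
  · simp only [sepTowards, hc]
    ext v
    simp only [Set.mem_union, Set.mem_inter_iff, Set.mem_sdiff]
    tauto

end Components

/-! # The vertices attached to an ultrafilter tangle -/

section UltrafilterTangle

variable {G : SimpleGraph V} {τ : Set (Set V × Set V)}

theorem IsTangle.away_mem (hτ : IsTangle G τ) {X : Finset V} (hX : X ∈ freeSets G τ)
    (C : G.ComponentCompl (X : Set V)) : (↑X ∪ C.supp, C.suppᶜ) ∈ τ := by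
  have h := (hτ.1.2.1 _ (isSeparation_sepTowards X.finite_toSet {C})).resolve_left (hX C)
  simpa [sepTowards, compVerts] using h

/-- A vertex outside `X` lies in a component of `G - X`, and freeness makes the tangle point away
from that component. -/
theorem IsTangle.core_subset_of_free (hτ : IsTangle G τ) {X : Finset V}
    (hX : X ∈ freeSets G τ) : tangleCore τ ⊆ X := by
  intro x hx
  by_contra hxX
  exact mem_tangleCore.1 hx _ (hτ.away_mem hX (G.componentComplMk hxX))
    (SimpleGraph.componentComplMk_mem G hxX)

/-- Suppose `τ` points to a component `C` of `G - W`. Some `t ∈ τ` has its big side inside `W ∪ C`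
and meets `X` only in `W`. Going higher in `τ` avoids the finitely many components of `G - X` that
meet the separator of `t`. Any other component `D` of `G - X` met there has all its neighbours
outside `D` in `W`, so it contains `C`; pointing away from `D` then leaves a big side inside `W`. -/
theorem IsTangle.mem_freeSets_of_core (hτ : IsTangle G τ) {X W : Finset V}
    (hX : X ∈ freeSets G τ) (hW : (W : Set V) = tangleCore τ) : W ∈ freeSets G τ := by
  intro C hC
  have hWX : (W : Set V) ⊆ X := hW ▸ hτ.core_subset_of_free hX
  have hout : ∀ x : V, ∃ s ∈ τ, x ∈ s.2 → x ∈ W := by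
    intro x
    by_cases hx : x ∈ W
    · obtain ⟨s, hs⟩ := hτ.nonempty
      exact ⟨s, hs, fun _ => hx⟩
    · have : x ∉ tangleCore τ := by rw [← hW]; exact hx
      rw [mem_tangleCore] at this
      push Not at this
      obtain ⟨s, hs, hxs⟩ := this
      exact ⟨s, hs, fun h => absurd h hxs⟩
  choose f hfτ hf using hout
  obtain ⟨t, ht, hle⟩ := hτ.exists_le_of_finite
    (F := insert (sepTowards G {C}) (f '' X)) ((X.finite_toSet.image f).insert _) (by
      rintro _ (rfl | ⟨x, -, rfl⟩)
      exacts [hC, hfτ x])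
  have htC : t.2 ⊆ W ∪ C.supp := by
    have := (hle _ (Set.mem_insert _ _)).2
    simpa [sepTowards, compVerts] using this
  have htX : t.2 ∩ X ⊆ W := fun x hx =>
    hf x ((hle _ (Or.inr ⟨x, hx.2, rfl⟩)).2 hx.1)
  have ht' := hτ.isSeparation ht
  -- enlarge the small side by all components of `G - X` that meet the separator of `t`
  have haway : ∀ z : V, ∃ s ∈ τ, ∀ D : G.ComponentCompl (X : Set V), z ∈ D.supp →
      s.2 ⊆ D.suppᶜ := by
    intro z
    by_cases hz : z ∈ (X : Set V)
    · obtain ⟨s, hs⟩ := hτ.nonempty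
      exact ⟨s, hs, fun D hD => absurd hz (notMem_of_mem_supp hD)⟩
    · refine ⟨_, hτ.away_mem hX (G.componentComplMk hz), fun D hD => ?_⟩
      rw [component_eq_of_mem hD (SimpleGraph.componentComplMk_mem G hz)]
  choose g hgτ hg using haway
  obtain ⟨t', ht'τ, hle'⟩ := hτ.exists_le_of_finite
    (F := insert t (g '' (t.1 ∩ t.2))) ((ht'.2.1.image g).insert _) (by
      rintro _ (rfl | ⟨x, -, rfl⟩)
      exacts [ht, hgτ x])
  have hsub : t'.2 ⊆ W ∪ C.supp := (hle' _ (Set.mem_insert _ _)).2.trans htC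
  have hsubC : ∀ v ∈ t'.2, v ∉ W → v ∈ C.supp := fun v hv hvW => (hsub hv).resolve_left hvW
  obtain ⟨v, hv, hvW⟩ : ∃ v ∈ t'.2, v ∉ (W : Set V) :=
    ((hτ.infinite_snd ht'τ).sdiff W.finite_toSet).nonempty
  have hvt : v ∈ t.2 := (hle' _ (Set.mem_insert _ _)).2 hv
  have hvX : v ∉ (X : Set V) := fun h => hvW (htX ⟨hvt, h⟩)
  set D := G.componentComplMk hvX with hD
  have hvD : v ∈ D.supp := SimpleGraph.componentComplMk_mem G hvX
  have hDZ : ∀ z ∈ D.supp, z ∉ t.1 ∩ t.2 := fun z hz hzt =>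
    hg z D hz ((hle' _ (Or.inr ⟨z, hzt, rfl⟩)).2 hv) hvD
  have hDt : D.supp ⊆ {z ∈ D.supp | z ∈ t.2 \ t.1} := by
    refine supp_subset_of_closed D ?_ hvD ⟨hvD, hvt, fun h => hDZ v hvD ⟨h, hvt⟩⟩
    intro a ha b hb hab
    have hbD := mem_supp_of_adj ha.1 hb hab
    exact ⟨hbD, ht'.diff_closed a ha.2 b (hDZ b hbD) hab⟩
  have hCD : C.supp ⊆ D.supp := by
    refine supp_subset_of_closed C ?_ (hsubC v hv hvW) hvD
    intro a ha b hb hab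
    by_cases hbX : b ∈ (X : Set V)
    · have hat := (hDt ha).2
      have hbt := ht'.both_mem_or hab
      exact absurd (htX ⟨(hbt.resolve_left fun h => hat.2 h.1).2, hbX⟩) hb
    · exact mem_supp_of_adj ha hbX hab
  refine hτ.infinite_snd (hτ.join_mem ht'τ (hτ.away_mem hX D)) (W.finite_toSet.subset ?_)
  intro w hw
  exact (hsub hw.1).resolve_right fun h => hw.2 (hCD h)

theorem IsUltrafilterTangle.exists_least (h : IsUltrafilterTangle G τ) :
    ∃ W : Finset V, (W : Set V) = tangleCore τ ∧ IsLeast (freeSets G τ) W := by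
  obtain ⟨hτ, X, hX⟩ := h
  have hfin : (tangleCore τ).Finite := X.finite_toSet.subset (hτ.core_subset_of_free hX)
  refine ⟨hfin.toFinset, by simp, hτ.mem_freeSets_of_core hX (by simp), ?_⟩
  intro Y hY
  have := hτ.core_subset_of_free hY
  intro v hv
  exact this (by simpa using hv)

end UltrafilterTangle

/-! # End tangles -/

section EndTangle

variable {G : SimpleGraph V} {ω : GraphEnd G}

theorem HasTailIn.mono {R : Ray G} {S T : Set V} (h : HasTailIn R S) (hST : S ⊆ T) :
    HasTailIn R T := by
  obtain ⟨N, hN⟩ := h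
  exact ⟨N, fun n hn => hST (hN n hn)⟩

theorem HasTailIn.inter {R : Ray G} {S T : Set V} (h : HasTailIn R S) (h' : HasTailIn R T) :
    HasTailIn R (S ∩ T) := by
  obtain ⟨N, hN⟩ := h
  obtain ⟨M, hM⟩ := h'
  exact ⟨max N M, fun n hn => ⟨hN n (le_of_max_le_left hn), hM n (le_of_max_le_right hn)⟩⟩

theorem HasTailIn.infinite {R : Ray G} {S : Set V} (h : HasTailIn R S) : S.Infinite := by
  obtain ⟨N, hN⟩ := h
  intro hfin
  have h1 : (R.vert ⁻¹' S).Finite := hfin.preimage R.inj.injOn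
  exact Set.Ici_infinite N (h1.subset fun n hn => hN n hn)

theorem GraphEnd.exists_mem (ω : GraphEnd G) : ∃ R : Ray G, R.Mem ω := Quotient.exists_rep ω

/-- Equivalent rays have tails in the same component, so a single ray of `ω` decides membership. -/
theorem mem_endTangle_iff {R : Ray G} (hR : R.Mem ω) {s : Set V × Set V} :
    s ∈ endTangle ω ↔ IsSeparation G s ∧ HasTailIn R (s.2 \ s.1) := by
  constructor
  · rintro ⟨hs, C, hC, hCs⟩
    exact ⟨hs, (hC R hR).mono hCs⟩
  · rintro ⟨hs, hT⟩
    obtain ⟨C, hC⟩ := exists_comp_hasTail R hs.2.1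
    refine ⟨hs, C, ?_, ?_⟩
    · intro R' hR'
      have hRR' : RayEquiv R R' := Quotient.exact (hR.trans hR'.symm)
      obtain ⟨D, hD, hD'⟩ := hRR' _ hs.2.1
      obtain ⟨v, hv⟩ := (hC.inter hD).infinite.nonempty
      rwa [component_eq_of_mem hv.1 hv.2]
    · obtain ⟨v, hv⟩ := (hC.inter hT).infinite.nonempty
      exact hs.supp_subset C hv.1 hv.2

theorem hasTailIn_or {R : Ray G} {s : Set V × Set V} (hs : IsSeparation G s) :
    HasTailIn R (s.2 \ s.1) ∨ HasTailIn R (s.1 \ s.2) := by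
  obtain ⟨C, hC⟩ := exists_comp_hasTail R hs.2.1
  obtain ⟨v, hv⟩ := hC.infinite.nonempty
  have hvX := notMem_of_mem_supp hv
  by_cases hv1 : v ∈ s.1
  · right
    have hv2 : v ∉ s.2 := fun h => hvX ⟨hv1, h⟩
    refine hC.mono (supp_subset_of_closed C ?_ hv ⟨hv1, hv2⟩)
    intro a ha b hb hab
    have := hs.swap.diff_closed a ha b (by rwa [Prod.fst_swap, Prod.snd_swap, Set.inter_comm]) hab
    exact this
  · left
    exact hC.mono (hs.supp_subset C hv ⟨(hs.mem_or v).resolve_left hv1, hv1⟩)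

/-- Sets containing a tail of a fixed ray are infinite and closed under finite intersections;
together with `hasTailIn_or` this yields the tangle axioms. -/
theorem isTangle_endTangle (ω : GraphEnd G) : IsTangle G (endTangle ω) := by
  obtain ⟨R, hR⟩ := ω.exists_mem
  refine ⟨⟨fun s hs => hs.1, fun s hs => ?_, fun s hs hs' => ?_⟩, ?_, ?_⟩
  · rcases hasTailIn_or (R := R) hs with h | h
    · exact Or.inl ((mem_endTangle_iff hR).2 ⟨hs, h⟩)
    · exact Or.inr ((mem_endTangle_iff hR).2 ⟨hs.swap, h⟩)
  · obtain ⟨v, hv⟩ := (((mem_endTangle_iff hR).1 hs).2.inter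
      ((mem_endTangle_iff hR).1 hs').2).infinite.nonempty
    exact absurd hv.2.1 hv.1.2
  · rintro s hs t ht - ⟨hst, -⟩
    obtain ⟨v, hv⟩ := (((mem_endTangle_iff hR).1 hs).2.inter
      ((mem_endTangle_iff hR).1 ht).2).infinite.nonempty
    exact hv.2.2 (hst.1 hv.1.1)
  · intro σ hσ hfin _
    refine HasTailIn.infinite (R := R) ?_
    have : ∀ F : Set (Set V × Set V), F.Finite → F ⊆ σ → HasTailIn R (starInterior F) := by
      intro F hF
      induction F, hF using Set.Finite.induction_on with
      | empty => exact fun _ => ⟨0, fun n _ => by simp [starInterior]⟩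
      | @insert a F _ _ ih =>
        intro hF
        have h1 := ih ((Set.subset_insert _ _).trans hF)
        have h2 := ((mem_endTangle_iff hR).1 (hσ (hF (Set.mem_insert a F)))).2
        refine (h2.inter h1).mono ?_
        intro v hv
        have := hv.2
        simp only [starInterior, Set.mem_iInter] at this ⊢
        rintro t (rfl | ht)
        exacts [hv.1.1, this t ht]
    exact this σ hfin subset_rfl

theorem IsSeparation.exists_mem_support {s : Set V × Set V} (hs : IsSeparation G s) {v w : V}
    (p : G.Walk v w) (hv : v ∉ s.2) (hw : w ∈ s.2) : ∃ x ∈ p.support, x ∈ s.1 ∩ s.2 := by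
  induction p with
  | nil => exact absurd hw hv
  | @cons a b c h p ih =>
    by_cases hb : b ∈ s.2
    · have := (hs.both_mem_or h).resolve_right fun h => hv h.1
      exact ⟨b, by simp, this.2, hb⟩
    · obtain ⟨x, hx, hxs⟩ := ih hb hw
      exact ⟨x, by simp [hx], hxs⟩

/-- If `v` is outside a big side, infinitely many paths of the fan from `v` end in that side and
cross the finite separator. Two of them share a separator vertex, which must be `v`, a
contradiction. -/
theorem dominatingVerts_subset_core (ω : GraphEnd G) :
    dominatingVerts ω ⊆ tangleCore (endTangle ω) := by
  rintro v ⟨R, hR, w, p, -, hw, -, hp⟩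
  rw [mem_tangleCore]
  intro s hs
  by_contra hv
  obtain ⟨hs', N, hN⟩ := (mem_endTangle_iff hR).1 hs
  have hinj : Function.Injective w := by
    intro i j hij
    by_contra hne
    exact (hw i).2 (hp i j hne _ (by simp) (by rw [hij]; simp))
  have hI : {i | w i ∈ s.2}.Infinite := by
    -- The ends `w i` are distinct, so only finitely many lie on the initial segment of `R` before
    -- its tail in `s.2`.
    have hfin : {i | w i ∈ R.vert '' Set.Iio N}.Finite :=
      ((Set.finite_Iio N).image _).preimage hinj.injOn
    refine (hfin.infinite_compl).mono ?_
    intro i hi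
    obtain ⟨n, hn⟩ := (hw i).1
    by_cases hnN : n < N
    · exact absurd ⟨n, hnN, hn⟩ hi
    · have := (hN n (not_lt.1 hnN)).1
      rwa [hn] at this
  have hx : ∀ i, ∃ x, w i ∈ s.2 → x ∈ (p i).support ∧ x ∈ s.1 ∩ s.2 := by
    intro i
    by_cases hi : w i ∈ s.2
    · obtain ⟨x, h⟩ := hs'.exists_mem_support (p i) hv hi
      exact ⟨x, fun _ => h⟩
    · exact ⟨v, fun h => absurd h hi⟩
  choose x hx using hx
  obtain ⟨i, hi, j, hj, hij, hxij⟩ := hI.exists_ne_map_eq_of_mapsTo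
    (f := x) (t := s.1 ∩ s.2) (fun i hi => (hx i hi).2) hs'.2.1
  have h1 := hp i j hij (x i) (hx i hi).1 (hxij ▸ (hx j hj).1)
  exact hv (h1 ▸ (hx i hi).2.2)

/-- A vertex of the core of an end tangle can be joined to every ray of the end, avoiding any given
finite set of other vertices. -/
theorem exists_walk_avoiding {R : Ray G} (hR : R.Mem ω) {v : V}
    (hv : v ∈ tangleCore (endTangle ω)) {X : Set V} (hX : X.Finite) (hvX : v ∉ X) :
    ∃ w ∈ Set.range R.vert, w ≠ v ∧ ∃ p : G.Walk v w, ∀ x ∈ p.support, x ∉ X := by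
  by_contra! hcon
  -- The set reachable from `v` off `X` would miss `R - v`, so the end tangle would contain `(X ∪ C,
  -- Cᶜ)` and separate `v` from `ω`.
  set C : Set V := {w | ∃ p : G.Walk v w, ∀ x ∈ p.support, x ∉ X} with hC
  have hcl : ∀ a ∈ C, ∀ b ∉ X, G.Adj a b → b ∈ C := by
    rintro a ⟨p, hp⟩ b hb hab
    refine ⟨p.concat hab, fun x hx => ?_⟩
    rw [SimpleGraph.Walk.support_concat] at hx
    simp only [List.mem_append, List.mem_singleton] at hx
    rcases hx with hx | rfl
    exacts [hp x hx, hb]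
  have hCX : ∀ a ∈ C, a ∉ X := by
    rintro a ⟨p, hp⟩
    exact hp a (by simp)
  have hvC : v ∈ C := ⟨.nil, by simpa using hvX⟩
  have hsep : IsSeparation G (X ∪ C, Cᶜ) := by
    refine ⟨?_, hX.subset ?_, ?_⟩
    · ext w
      simp only [Set.mem_union, Set.mem_compl_iff, Set.mem_univ, iff_true]
      tauto
    · intro w hw
      exact hw.1.resolve_right hw.2
    · intro a ha b hb hab
      exact hb.2 (Or.inr (hcl a (not_not.1 ha.2) b (fun h => hb.2 (Or.inl h)) hab))
  refine mem_tangleCore.1 hv _ ((mem_endTangle_iff hR).2 ⟨hsep, ?_⟩) hvC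
  have hfin : {n | R.vert n ∈ insert v X}.Finite := (hX.insert v).preimage R.inj.injOn
  obtain ⟨N, hN⟩ := hfin.bddAbove
  refine ⟨N + 1, fun n hn => ?_⟩
  have hnv : R.vert n ∉ insert v X := fun h => by
    have := hN h
    omega
  have hnC : R.vert n ∉ C := by
    rintro ⟨p, hp⟩
    obtain ⟨x, hx, hxX⟩ := hcon _ ⟨n, rfl⟩ (fun h => hnv (Or.inl h)) p
    exact hp x hx hxX
  exact ⟨hnC, fun h => h.elim (fun h => hnv (Or.inr h)) hnC⟩

theorem exists_path_avoiding {R : Ray G} (hR : R.Mem ω) {v : V}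
    (hv : v ∈ tangleCore (endTangle ω)) {X : Set V} (hX : X.Finite) (hvX : v ∉ X) :
    ∃ (w : V) (p : G.Walk v w), p.IsPath ∧ w ∈ Set.range R.vert ∧ w ≠ v ∧
      (∀ x ∈ p.support, x ∉ X) ∧
      ∀ x ∈ p.support, x ∈ Set.range R.vert → x = v ∨ x = w := by
  classical
  set S : Set (Σ w, G.Walk v w) :=
    {q | q.1 ∈ Set.range R.vert ∧ q.1 ≠ v ∧ ∀ x ∈ q.2.support, x ∉ X} with hS
  have hne : S.Nonempty := by
    obtain ⟨w, hw, hwv, p, hp⟩ := exists_walk_avoiding hR hv hX hvX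
    exact ⟨⟨w, p⟩, hw, hwv, hp⟩
  -- The minimum is over all target vertices on `R - v`: an earlier hit of `R` would give a shorter
  -- walk.
  obtain ⟨⟨w, p⟩, ⟨hw, hwv, hp⟩, hmin⟩ :=
    WellFounded.has_min (measure fun q : Σ w, G.Walk v w => q.2.length).wf S hne
  have hlen : p.bypass.length ≤ p.length := p.length_bypass_le_length
  have hsub : ∀ x ∈ p.bypass.support, x ∉ X := fun x hx => hp x (p.support_bypass_subset_support hx)
  refine ⟨w, p.bypass, p.bypass_isPath, hw, hwv, hsub, ?_⟩
  intro x hx hxR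
  by_contra! hne
  refine hmin ⟨x, p.bypass.takeUntil x hx⟩
    ⟨hxR, hne.1, fun y hy => hsub y (p.bypass.support_takeUntil_subset_support hx hy)⟩ ?_
  have := SimpleGraph.Walk.length_takeUntil_lt_length hx hne.2
  change (p.bypass.takeUntil x hx).length < p.length
  omega

/-- The fan is built greedily: each new path avoids all earlier paths except at `v`, a finite set of
forbidden vertices. -/
theorem core_endTangle (ω : GraphEnd G) : tangleCore (endTangle ω) = dominatingVerts ω := by
  refine Set.Subset.antisymm ?_ (dominatingVerts_subset_core ω)
  intro v hv
  obtain ⟨R, hR⟩ := ω.exists_mem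
  obtain ⟨f, hf, hff⟩ := exists_seq_of_forall_finset_exists
    (fun q : Σ w, G.Walk v w => q.2.IsPath ∧ q.1 ∈ Set.range R.vert ∧ q.1 ≠ v ∧
      ∀ x ∈ q.2.support, x ∈ Set.range R.vert → x = v ∨ x = q.1)
    (fun p q => ∀ x ∈ p.2.support, x ∈ q.2.support → x = v) (by
      intro s _
      have hfin : ((⋃ q ∈ s, {x | x ∈ q.2.support}) \ {v}).Finite :=
        (s.finite_toSet.biUnion fun q _ => q.2.support.finite_toSet).sdiff
      obtain ⟨w, p, h1, h2, h3, h4, h5⟩ := exists_path_avoiding hR hv hfin (by simp)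
      refine ⟨⟨w, p⟩, ⟨h1, h2, h3, h5⟩, fun q hq x hxq hxp => ?_⟩
      by_contra hxv
      exact h4 x hxp ⟨Set.mem_biUnion hq hxq, hxv⟩)
  refine ⟨R, hR, fun i => (f i).1, fun i => (f i).2, fun i => (hf i).1,
    fun i => ⟨(hf i).2.1, (hf i).2.2.1⟩, fun i => (hf i).2.2.2, ?_⟩
  intro i j hij x hxi hxj
  rcases lt_or_gt_of_ne hij with h | h
  exacts [hff i j h x hxi hxj, hff j i h x hxj hxi]

end EndTangle

/-! # Functions on the 1-complex -/

section Functions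

variable {G : SimpleGraph V} (r : Representation G)

theorem Representation.adj (e : G.edgeSet) : G.Adj (r.src e) (r.tgt e) := by
  have := e.2
  rwa [← r.edge_eq e] at this

theorem Representation.src_ne_tgt (e : G.edgeSet) : r.src e ≠ r.tgt e := (r.adj e).ne

theorem glue_zero (e : G.edgeSet) : glue r ⟨e, 0⟩ = .vertex (r.src e) := by simp [glue]

theorem glue_one (e : G.edgeSet) : glue r ⟨e, 1⟩ = .vertex (r.tgt e) := by simp [glue]

theorem inner_eq_glue (e : G.edgeSet) (t : Set.Ioo (0 : ℝ) 1) :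
    OneComplex.inner e t = glue r ⟨e, ⟨t, t.2.1.le, t.2.2.le⟩⟩ := by
  have h0 : (⟨t, t.2.1.le, t.2.2.le⟩ : unitInterval) ≠ 0 := fun h =>
    t.2.1.ne' (congrArg Subtype.val h)
  have h1 : (⟨t, t.2.1.le, t.2.2.le⟩ : unitInterval) ≠ 1 := fun h =>
    t.2.2.ne (congrArg Subtype.val h)
  simp [glue, h0, h1]

theorem glue_cases (e : G.edgeSet) (t : unitInterval) :
    (t = 0 ∧ glue r ⟨e, t⟩ = .vertex (r.src e)) ∨ (t = 1 ∧ glue r ⟨e, t⟩ = .vertex (r.tgt e)) ∨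
      ∃ t', glue r ⟨e, t⟩ = .inner e t' ∧ (t' : ℝ) = t := by
  by_cases h0 : t = 0
  · subst h0
    exact Or.inl ⟨rfl, glue_zero r e⟩
  · by_cases h1 : t = 1
    · subst h1
      exact Or.inr (Or.inl ⟨rfl, glue_one r e⟩)
    · exact Or.inr (Or.inr ⟨_, by simp only [glue, dif_neg h0, dif_neg h1]; rfl, rfl⟩)

variable {r}

theorem inducedComplex_mono {W W' : Set V} (h : W ⊆ W') :
    inducedComplex r W ⊆ inducedComplex r W' := by
  rintro (v | ⟨e, t⟩) hx
  exacts [h hx, ⟨h hx.1, h hx.2⟩]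

theorem glue_mem_induced {W : Set V} {e : G.edgeSet} (h0 : r.src e ∈ W) (h1 : r.tgt e ∈ W)
    (t : unitInterval) : glue r ⟨e, t⟩ ∈ inducedComplex r W := by
  rcases glue_cases r e t with ⟨-, h⟩ | ⟨-, h⟩ | ⟨t', h, -⟩ <;> rw [h]
  exacts [h0, h1, ⟨h0, h1⟩]

theorem continuous_oneComplex_iff {Z : Type*} [TopologicalSpace Z] {f : OneComplex r → Z} :
    Continuous f ↔ ∀ e : G.edgeSet, Continuous fun t : unitInterval => f (glue r ⟨e, t⟩) := by
  rw [continuous_coinduced_dom, continuous_sigma_iff]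
  rfl

theorem continuous_glue_edge (e : G.edgeSet) :
    Continuous fun t : unitInterval => glue r ⟨e, t⟩ :=
  (continuous_glue r).comp continuous_sigmaMk

/-- A function on the 1-complex, given by its values on the vertices and on the edges. -/
def liftFn {Z : Type*} (r : Representation G) (h : V → Z) (g : G.edgeSet → unitInterval → Z) :
    OneComplex r → Z
  | .vertex v => h v
  | .inner e t => g e ⟨t, t.2.1.le, t.2.2.le⟩

theorem liftFn_glue {Z : Type*} {h : V → Z} {g : G.edgeSet → unitInterval → Z}
    (h0 : ∀ e, g e 0 = h (r.src e)) (h1 : ∀ e, g e 1 = h (r.tgt e)) (e : G.edgeSet)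
    (t : unitInterval) : liftFn r h g (glue r ⟨e, t⟩) = g e t := by
  rcases glue_cases r e t with ⟨rfl, h⟩ | ⟨rfl, h⟩ | ⟨t', h, ht'⟩ <;> rw [h]
  · exact (h0 e).symm
  · exact (h1 e).symm
  · exact congrArg (g e) (Subtype.ext ht')

open Classical in
/-- The distance from `v` on an edge `e`, in units of `ε e` and truncated at `1`. -/
noncomputable def starEdge (r : Representation G) (v : V) (ε : G.edgeSet → Set.Ioc (0 : ℝ) 1)
    (e : G.edgeSet) (t : unitInterval) : unitInterval :=
  if r.src e = v then Set.projIcc 0 1 zero_le_one ((t : ℝ) / ε e)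
  else if r.tgt e = v then Set.projIcc 0 1 zero_le_one ((1 - t : ℝ) / ε e)
  else 1

open Classical in
/-- The distance from the vertex `v`, in units of `ε` and truncated at `1`. -/
noncomputable def starFn (r : Representation G) (v : V) (ε : G.edgeSet → Set.Ioc (0 : ℝ) 1) :
    OneComplex r → unitInterval :=
  liftFn r (fun w => if w = v then 0 else 1) (starEdge r v ε)

variable {v : V} {ε : G.edgeSet → Set.Ioc (0 : ℝ) 1} {e : G.edgeSet}

theorem projIcc_eq_one_iff {x : ℝ} : Set.projIcc (0 : ℝ) 1 zero_le_one x = 1 ↔ 1 ≤ x :=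
  Set.projIcc_eq_right (h := zero_lt_one)

/-- The bound `ε e ≤ 1` is what makes the value at the far end of an edge equal to `1`, as the
gluing requires. -/
theorem starFn_glue (t : unitInterval) : starFn r v ε (glue r ⟨e, t⟩) = starEdge r v ε e t := by
  refine liftFn_glue (fun e => ?_) (fun e => ?_) e t
  · have hne := r.src_ne_tgt e
    by_cases h : r.src e = v
    · simp [starEdge, h, Set.projIcc_left]
    · by_cases h' : r.tgt e = v
      · simp only [starEdge, h, h', if_false, if_true, projIcc_eq_one_iff]
        rw [one_le_div (ε e).2.1]
        simpa using (ε e).2.2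
      · simp [starEdge, h, h']
  · have hne := r.src_ne_tgt e
    by_cases h : r.src e = v
    · have h' : r.tgt e ≠ v := fun h' => hne (h.trans h'.symm)
      simp only [starEdge, h, h', if_false, if_true, projIcc_eq_one_iff]
      rw [one_le_div (ε e).2.1]
      exact (ε e).2.2
    · by_cases h' : r.tgt e = v
      · simp [starEdge, h, h', Set.projIcc_left]
      · simp [starEdge, h, h']

theorem starFn_vertex_self : starFn r v ε (.vertex v) = 0 := by simp [starFn, liftFn]

theorem starFn_vertex_of_ne {w : V} (h : w ≠ v) : starFn r v ε (.vertex w) = 1 := by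
  simp [starFn, liftFn, h]

theorem starEdge_eq_one_of_src (h : r.src e = v) {t : unitInterval} :
    starEdge r v ε e t = 1 ↔ (ε e : ℝ) ≤ t := by
  rw [starEdge, if_pos h, projIcc_eq_one_iff, one_le_div (ε e).2.1]

theorem starEdge_eq_one_of_tgt (h : r.tgt e = v) {t : unitInterval} :
    starEdge r v ε e t = 1 ↔ (ε e : ℝ) ≤ 1 - t := by
  have h' : r.src e ≠ v := fun h' => r.src_ne_tgt e (h'.trans h.symm)
  rw [starEdge, if_neg h', if_pos h, projIcc_eq_one_iff, one_le_div (ε e).2.1]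

theorem starEdge_of_ne (h : r.src e ≠ v) (h' : r.tgt e ≠ v) (t : unitInterval) :
    starEdge r v ε e t = 1 := by
  rw [starEdge, if_neg h, if_neg h']

theorem continuous_starFn : Continuous (starFn r v ε) := by
  rw [continuous_oneComplex_iff]
  intro e
  simp only [starFn_glue]
  unfold starEdge
  split_ifs
  · exact continuous_projIcc.comp (by fun_prop)
  · exact continuous_projIcc.comp (by fun_prop)
  · exact continuous_const

/-- The points of an edge that are off a star around `v` form an interval. -/
theorem ordConnected_starEdge : {t | starEdge r v ε e t = 1}.OrdConnected := by
  refine ⟨fun a ha b hb c hc => ?_⟩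
  by_cases h : r.src e = v
  · rw [Set.mem_ofPred_eq, starEdge_eq_one_of_src h] at ha ⊢
    exact ha.trans hc.1
  · by_cases h' : r.tgt e = v
    · rw [Set.mem_ofPred_eq, starEdge_eq_one_of_tgt h'] at hb ⊢
      have : (c : ℝ) ≤ b := hc.2
      linarith
    · exact starEdge_of_ne h h' c

open Classical in
/-- A function that is `1` precisely off the inner points of the edge `e`. -/
noncomputable def bumpFn (r : Representation G) (e : G.edgeSet) : OneComplex r → unitInterval :=
  liftFn r (fun _ => 1) fun e' t => if e' = e then unitInterval.symm (t * unitInterval.symm t) else 1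

open Classical in
theorem bumpFn_glue (e' : G.edgeSet) (t : unitInterval) :
    bumpFn r e (glue r ⟨e', t⟩) =
      if e' = e then unitInterval.symm (t * unitInterval.symm t) else 1 :=
  liftFn_glue (by simp) (by simp) e' t

theorem continuous_bumpFn : Continuous (bumpFn r e) := by
  classical
  rw [continuous_oneComplex_iff]
  intro e'
  simp only [bumpFn_glue]
  split_ifs <;> fun_prop

theorem bumpFn_inner_ne (t : Set.Ioo (0 : ℝ) 1) : bumpFn r e (.inner e t) ≠ 1 := by
  classical
  rw [inner_eq_glue, bumpFn_glue, if_pos rfl]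
  intro h
  have h1 := congrArg Subtype.val h
  simp only [unitInterval.coe_symm_eq, Set.Icc.coe_mul, Set.Icc.coe_one] at h1
  have := mul_pos t.2.1 (sub_pos.2 t.2.2)
  linarith

theorem bumpFn_of_ne {x : OneComplex r} (hx : ∀ t, x ≠ .inner e t) : bumpFn r e x = 1 := by
  rcases x with v | ⟨e', t⟩
  · rfl
  · have h : e' ≠ e := by
      rintro rfl
      exact hx t rfl
    simp [bumpFn, liftFn, h]

/-! # The remainder -/

theorem stoneCechExtend_mem {Y Z : Type*} [TopologicalSpace Y] [TopologicalSpace Z] [T2Space Z]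
    [CompactSpace Z] {f : Y → Z} (hf : Continuous f) {S : Set Y} {T : Set Z} (hT : IsClosed T)
    (hS : ∀ x ∈ S, f x ∈ T) {p : StoneCech Y} (hp : p ∈ closure (stoneCechUnit '' S)) :
    stoneCechExtend hf p ∈ T := by
  have : closure (stoneCechUnit '' S) ⊆ stoneCechExtend hf ⁻¹' T := by
    refine closure_minimal ?_ (hT.preimage (continuous_stoneCechExtend hf))
    rintro _ ⟨x, hx, rfl⟩
    simpa using hS x hx
  exact this hp

theorem unit_notMem_closure {Y : Type*} [TopologicalSpace Y] {f : Y → unitInterval}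
    (hf : Continuous f) {S : Set Y} (hS : ∀ x ∈ S, f x = 1) {y : Y} (hy : f y ≠ 1) :
    stoneCechUnit y ∉ closure (stoneCechUnit '' S) := by
  intro h
  have := stoneCechExtend_mem hf isClosed_singleton (T := {1}) (by simpa using hS) h
  rw [stoneCechExtend_stoneCechUnit] at this
  exact hy this

theorem vertexPt_notMem_closure {S : Set (OneComplex r)} (hS : ∀ x ∈ S, starFn r v ε x = 1) :
    vertexPt r v ∉ closure (stoneCechUnit '' S) :=
  unit_notMem_closure continuous_starFn hS (by rw [starFn_vertex_self]; exact zero_ne_one)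

theorem inner_notMem_closure {S : Set (OneComplex r)} (hS : ∀ x ∈ S, ∀ t, x ≠ .inner e t)
    (t : Set.Ioo (0 : ℝ) 1) :
    stoneCechUnit (OneComplex.inner e t) ∉ closure (stoneCechUnit '' S) :=
  unit_notMem_closure continuous_bumpFn (fun x hx => bumpFn_of_ne (hS x hx)) (bumpFn_inner_ne t)

theorem starFn_induced_eq_one {W : Set V} (hv : v ∉ W) {x : OneComplex r}
    (hx : x ∈ inducedComplex r W) : starFn r v ε x = 1 := by
  rcases x with w | ⟨e, t⟩
  · exact starFn_vertex_of_ne fun h => hv (h ▸ hx)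
  · rw [inner_eq_glue, starFn_glue]
    refine starEdge_of_ne ?_ ?_ _
    · rintro rfl
      exact hv hx.1
    · rintro rfl
      exact hv hx.2

theorem mem_of_vertexPt_mem_closure {W : Set V}
    (h : vertexPt r v ∈ closure (stoneCechUnit '' inducedComplex r W)) : v ∈ W := by
  by_contra hv
  exact vertexPt_notMem_closure (ε := fun _ => ⟨1, by simp⟩)
    (fun x hx => starFn_induced_eq_one hv hx) h

/-- The test used for all points of the remainder. Approximating `z` from outside a star rules out
its centre, and approximating it from outside an open edge rules out the inner points of that edge.
-/
theorem mem_remainder_of {z : StoneCech (OneComplex r)}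
    (h : ∀ v, ∃ ε, z ∈ closure (stoneCechUnit '' {x | starFn r v ε x = 1}))
    (h' : ∀ e, z ∈ closure (stoneCechUnit '' {x : OneComplex r | ∀ t, x ≠ .inner e t})) :
    z ∈ remainder r := by
  rintro ⟨v | ⟨e, t⟩, rfl⟩
  · obtain ⟨ε, hε⟩ := h v
    exact vertexPt_notMem_closure (fun x hx => hx) hε
  · exact inner_notMem_closure (fun x hx => hx) t (h' e)

theorem exists_radius {P : unitInterval → Prop} (hP : IsOpen {t | P t}) (h0 : r.src e = v → P 0)
    (h1 : r.tgt e = v → P 1) :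
    ∃ δ : Set.Ioc (0 : ℝ) 1, ∀ t : unitInterval, (r.src e = v → (t : ℝ) < δ → P t) ∧
      (r.tgt e = v → 1 - (t : ℝ) < δ → P t) := by
  have key : ∀ a : unitInterval, P a → ∃ δ : Set.Ioc (0 : ℝ) 1, ∀ t : unitInterval,
      |(t : ℝ) - a| < δ → P t := by
    intro a ha
    obtain ⟨δ, hδ, h⟩ := Metric.isOpen_iff.1 hP a ha
    refine ⟨⟨min δ 1, by positivity, min_le_right _ _⟩, fun t ht => h ?_⟩
    rw [Metric.mem_ball, Subtype.dist_eq, Real.dist_eq]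
    exact ht.trans_le (min_le_left _ _)
  by_cases hs : r.src e = v
  · obtain ⟨δ, hδ⟩ := key 0 (h0 hs)
    refine ⟨δ, fun t => ⟨fun _ ht => hδ t ?_, fun h => absurd (hs.trans h.symm) (r.src_ne_tgt e)⟩⟩
    simpa [abs_of_nonneg t.2.1] using ht
  · by_cases ht : r.tgt e = v
    · obtain ⟨δ, hδ⟩ := key 1 (h1 ht)
      refine ⟨δ, fun t => ⟨fun h => absurd h hs, fun _ ht => hδ t ?_⟩⟩
      rw [abs_sub_comm]
      simpa [abs_of_nonneg (sub_nonneg.2 t.2.2)] using ht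
    · exact ⟨⟨1, by simp⟩, fun t => ⟨fun h => absurd h hs, fun h => absurd h ht⟩⟩

/-- In the quotient topology every neighbourhood of `v` contains a star around `v`, provided the
radius may depend on the edge; no uniform radius need exist at a vertex of infinite degree. -/
theorem exists_starFn_separating {z : StoneCech (OneComplex r)} (hz : z ≠ vertexPt r v) :
    ∃ ε, z ∉ closure (stoneCechUnit '' {x | starFn r v ε x ≠ 1}) := by
  obtain ⟨M, N, hM, hN, hzM, hvN, hMN⟩ := t2_separation hz
  have hopen : ∀ e, IsOpen {t : unitInterval | stoneCechUnit (glue r ⟨e, t⟩) ∈ N} := fun e =>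
    hN.preimage (continuous_stoneCechUnit.comp (continuous_glue_edge e))
  have hex : ∀ e, _ := fun e => exists_radius (r := r) (e := e) (v := v) (hopen e)
    (fun h => by rw [glue_zero, h]; exact hvN) (fun h => by rw [glue_one, h]; exact hvN)
  choose ε hε using hex
  refine ⟨ε, fun hcl => ?_⟩
  obtain ⟨_, hx, x, hx1, rfl⟩ := mem_closure_iff.1 hcl M hM hzM
  refine Set.disjoint_left.1 hMN hx ?_
  rcases x with w | ⟨e, t⟩
  · by_cases h : w = v
    · exact h ▸ hvN
    · exact absurd (starFn_vertex_of_ne h) hx1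
  · rw [Set.mem_ofPred_eq, inner_eq_glue, starFn_glue] at hx1
    rw [inner_eq_glue]
    by_cases h : r.src e = v
    · rw [Ne, starEdge_eq_one_of_src h, not_le] at hx1
      exact (hε e _).1 h hx1
    · by_cases h' : r.tgt e = v
      · rw [Ne, starEdge_eq_one_of_tgt h', not_le] at hx1
        exact (hε e _).2 h' hx1
      · exact absurd (starEdge_of_ne h h' _) hx1

theorem isCompact_inducedComplex {W : Set V} (hW : W.Finite) : IsCompact (inducedComplex r W) := by
  have hE : {e : G.edgeSet | r.src e ∈ W ∧ r.tgt e ∈ W}.Finite := by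
    -- The graph is simple, so an edge is determined by its pair of ends.
    refine Set.Finite.of_finite_image (f := fun e => (r.src e, r.tgt e))
      ((hW.prod hW).subset ?_) ?_
    · rintro _ ⟨e, he, rfl⟩
      exact he
    · intro e _ e' _ h
      simp only [Prod.mk.injEq] at h
      exact Subtype.ext (by rw [← r.edge_eq e, ← r.edge_eq e', h.1, h.2])
  have h1 : IsCompact (OneComplex.vertex (r := r) '' W) := (hW.image _).isCompact
  have h2 := hE.isCompact_biUnion (f := fun e => Set.range fun t : unitInterval => glue r ⟨e, t⟩)
    fun e _ => isCompact_range (continuous_glue_edge e)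
  convert h1.union h2 using 1
  ext x
  constructor
  · rcases x with v | ⟨e, t⟩
    · exact fun h => Or.inl ⟨v, h, rfl⟩
    · exact fun h => Or.inr (Set.mem_biUnion (x := e) h ⟨_, (inner_eq_glue r e t).symm⟩)
  · rintro (⟨v, h, rfl⟩ | h)
    · exact h
    · simp only [Set.mem_iUnion, exists_prop] at h
      obtain ⟨e, ⟨h0, h1⟩, t, rfl⟩ := h
      exact glue_mem_induced h0 h1 t

theorem isClosed_image_inducedComplex {W : Set V} (hW : W.Finite) :
    IsClosed (stoneCechUnit '' inducedComplex r W) :=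
  ((isCompact_inducedComplex hW).image continuous_stoneCechUnit).isClosed

theorem notMem_closure_induced {z : StoneCech (OneComplex r)} (hz : z ∈ remainder r) {W : Set V}
    (hW : W.Finite) : z ∉ closure (stoneCechUnit '' inducedComplex r W) := by
  rw [(isClosed_image_inducedComplex hW).closure_eq]
  rintro ⟨x, -, rfl⟩
  exact hz ⟨x, rfl⟩

/-- A closed edge lies in a compact finite subcomplex and so contributes nothing to the remainder;
the remainder is therefore in the closure of the points off the open edge. -/
theorem inner_notMem_closure_remainder (t : Set.Ioo (0 : ℝ) 1) :
    stoneCechUnit (OneComplex.inner e t) ∉ closure (remainder r) := by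
  intro h
  have hsub : remainder r ⊆ closure (stoneCechUnit '' {x : OneComplex r | ∀ t, x ≠ .inner e t}) := by
    intro z hz
    have huniv : z ∈ closure (stoneCechUnit '' ({x : OneComplex r | ∀ t, x ≠ .inner e t} ∪
        inducedComplex r {r.src e, r.tgt e})) := by
      have : ({x : OneComplex r | ∀ t, x ≠ .inner e t} ∪
          inducedComplex r {r.src e, r.tgt e}) = Set.univ := by
        ext x
        simp only [Set.mem_union, Set.mem_univ, iff_true]
        by_contra! hx
        obtain ⟨hx1, hx2⟩ := hx
        simp only [Set.mem_ofPred_eq, not_forall, not_not] at hx1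
        obtain ⟨t, rfl⟩ := hx1
        exact hx2 ⟨by simp, by simp⟩
      rw [this, Set.image_univ, denseRange_stoneCechUnit.closure_range]
      trivial
    rw [Set.image_union, closure_union] at huniv
    exact huniv.resolve_right (notMem_closure_induced hz (by simp))
  exact inner_notMem_closure (fun x hx => hx) t (closure_minimal hsub isClosed_closure h)

/-- The closures of the two sides of a separation meet only in the 1-complex itself. -/
theorem closure_inter_closure_subset {s : Set V × Set V} (hs : IsSeparation G s) :
    closure (stoneCechUnit '' inducedComplex r s.1) ∩
      closure (stoneCechUnit '' inducedComplex r s.2) ⊆ (remainder r)ᶜ := by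
  rintro p ⟨hp1, hp2⟩ hp
  have hpX := notMem_closure_induced hp hs.2.1
  -- Since `φ` vanishes on the overlap of the two sides, its sign may be flipped on one side without
  -- losing continuity. The extension to `βG` would then equal both `1` and `-1` at `p`.
  obtain ⟨φ, hφ0, hφ1, hφI⟩ := exists_continuous_zero_one_of_isClosed
    (isClosed_closure (s := stoneCechUnit '' inducedComplex r (s.1 ∩ s.2)))
    (isClosed_singleton (x := p)) (Set.disjoint_singleton_right.2 hpX)
  have hφX : ∀ x ∈ inducedComplex r (s.1 ∩ s.2), φ (stoneCechUnit x) = 0 := fun x hx =>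
    hφ0 (subset_closure ⟨x, hx, rfl⟩)
  have hφp : φ p = 1 := hφ1 rfl
  classical
  -- the function `φ` on the second side, and `-φ` on the first side
  let f : OneComplex r → ℝ := fun x =>
    if x ∈ inducedComplex r s.2 then φ (stoneCechUnit x) else - φ (stoneCechUnit x)
  have hf2 : ∀ x ∈ inducedComplex r s.2, f x = φ (stoneCechUnit x) := fun x hx => if_pos hx
  have hf1 : ∀ x ∈ inducedComplex r s.1, f x = - φ (stoneCechUnit x) := by
    intro x hx
    by_cases hx2 : x ∈ inducedComplex r s.2
    · have : x ∈ inducedComplex r (s.1 ∩ s.2) := by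
        rcases x with v | ⟨e, t⟩
        exacts [⟨hx, hx2⟩, ⟨⟨hx.1, hx2.1⟩, ⟨hx.2, hx2.2⟩⟩]
      rw [hf2 x hx2, hφX x this, neg_zero]
    · exact if_neg hx2
  have hfc : Continuous f := by
    rw [continuous_oneComplex_iff]
    intro e
    have hc : Continuous fun t : unitInterval => φ (stoneCechUnit (glue r ⟨e, t⟩)) :=
      φ.continuous.comp (continuous_stoneCechUnit.comp (continuous_glue_edge e))
    rcases hs.both_mem_or (r.adj e) with h | h
    · simp only [fun t => hf1 _ (glue_mem_induced h.1 h.2 t)]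
      exact hc.neg
    · simpa only [fun t => hf2 _ (glue_mem_induced h.1 h.2 t)] using hc
  have hfI : ∀ x, f x ∈ Set.Icc (-1 : ℝ) 1 := by
    intro x
    have := hφI (stoneCechUnit x)
    simp only [f]
    split_ifs <;> constructor <;> linarith [this.1, this.2]
  have hgc : Continuous fun x => (⟨f x, hfI x⟩ : Set.Icc (-1 : ℝ) 1) := hfc.subtype_mk _
  set F := stoneCechExtend hgc
  have hF : Continuous fun z => (F z : ℝ) :=
    continuous_subtype_val.comp (continuous_stoneCechExtend hgc)
  have hFx : ∀ x, (F (stoneCechUnit x) : ℝ) = f x := fun x => by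
    simp only [F, stoneCechExtend_stoneCechUnit]
  have h2 : (F p : ℝ) = φ p := by
    refine closure_minimal ?_ (isClosed_eq hF φ.continuous) hp2
    rintro _ ⟨x, hx, rfl⟩
    exact (hFx x).trans (hf2 x hx)
  have h1 : (F p : ℝ) = - φ p := by
    refine closure_minimal ?_ (isClosed_eq hF φ.continuous.neg) hp1
    rintro _ ⟨x, hx, rfl⟩
    exact (hFx x).trans (hf1 x hx)
  linarith

end Functions

/-! # The part of the remainder that a tangle points to -/

section TangleRemainder

variable {G : SimpleGraph V} {τ : Set (Set V × Set V)} {r : Representation G}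

/-- The points of the remainder that lie in the closures of all the big sides of `τ`. -/
def tangleRemainder (r : Representation G) (τ : Set (Set V × Set V)) :
    Set (StoneCech (OneComplex r)) :=
  {z | z ∈ remainder r ∧ ∀ s ∈ τ, z ∈ closure (stoneCechUnit '' inducedComplex r s.2)}

/-- The points of `G[B]` that are neither in `G[Y]` nor in the `ε`-stars around the vertices
in `Y`. -/
def offStars (r : Representation G) (ε : V → G.edgeSet → Set.Ioc (0 : ℝ) 1) (Y B : Set V) :
    Set (OneComplex r) :=
  {x | x ∈ inducedComplex r B ∧ x ∉ inducedComplex r Y ∧ ∀ v ∈ Y, starFn r v (ε v) x = 1}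

theorem offStars_mono {ε : V → G.edgeSet → Set.Ioc (0 : ℝ) 1} {Y Y' B B' : Set V} (hY : Y ⊆ Y')
    (hB : B' ⊆ B) : offStars r ε Y' B' ⊆ offStars r ε Y B := fun _ hx =>
  ⟨inducedComplex_mono hB hx.1, fun h => hx.2.1 (inducedComplex_mono hY h),
    fun v hv => hx.2.2 v (hY hv)⟩

theorem vertex_mem_offStars {ε : V → G.edgeSet → Set.Ioc (0 : ℝ) 1} {Y B : Set V} {v : V}
    (hB : v ∈ B) (hY : v ∉ Y) : OneComplex.vertex v ∈ offStars r ε Y B :=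
  ⟨hB, hY, fun _ hw => starFn_vertex_of_ne fun h => hY (h ▸ hw)⟩

/-- An edge in `G[B]` meets `offStars r ε Y B` in an interval. -/
theorem edge_subset_of_cover {ε : V → G.edgeSet → Set.Ioc (0 : ℝ) 1} {Y B : Set V}
    {O₁ O₂ : Set (OneComplex r)} (h₁ : IsOpen O₁) (h₂ : IsOpen O₂) (hdis : Disjoint O₁ O₂)
    (hcov : offStars r ε Y B ⊆ O₁ ∪ O₂) {e : G.edgeSet} (hs : r.src e ∈ B) (ht : r.tgt e ∈ B)
    (hY : ¬ (r.src e ∈ Y ∧ r.tgt e ∈ Y)) :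
    (∀ t, glue r ⟨e, t⟩ ∈ offStars r ε Y B → glue r ⟨e, t⟩ ∈ O₁) ∨
      (∀ t, glue r ⟨e, t⟩ ∈ offStars r ε Y B → glue r ⟨e, t⟩ ∈ O₂) := by
  set S : Set unitInterval := {t | glue r ⟨e, t⟩ ∈ offStars r ε Y B} with hS
  have hord : S.OrdConnected := by
    refine ⟨fun a ha b hb c hc => ?_⟩
    -- Strictly between `a` and `b`, the point is an inner edge point, hence in `G[Y]` only if both
    -- ends of the edge are in `Y`.
    rcases eq_or_lt_of_le hc.1 with rfl | hac
    · exact ha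
    rcases eq_or_lt_of_le hc.2 with rfl | hcb
    · exact hb
    refine ⟨glue_mem_induced hs ht c, ?_, fun v hv => ?_⟩
    · rcases glue_cases r e c with ⟨rfl, -⟩ | ⟨rfl, -⟩ | ⟨t', h, -⟩
      · exact absurd hac (not_lt.2 a.2.1)
      · exact absurd hcb (not_lt.2 b.2.2)
      · rw [h]
        exact hY
    · have h1 := ha.2.2 v hv
      have h2 := hb.2.2 v hv
      rw [starFn_glue] at h1 h2 ⊢
      exact ordConnected_starEdge.out h1 h2 hc
  have hpre : IsPreconnected ((fun t => glue r ⟨e, t⟩) '' S) :=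
    hord.isPreconnected.image _ (continuous_glue_edge e).continuousOn
  have hsub : (fun t => glue r ⟨e, t⟩) '' S ⊆ O₁ ∪ O₂ := by
    rintro _ ⟨t, ht, rfl⟩
    exact hcov ht
  rcases hpre.subset_or_subset h₁ h₂ hdis hsub with h | h
  · exact Or.inl fun t ht => h ⟨t, ht, rfl⟩
  · exact Or.inr fun t ht => h ⟨t, ht, rfl⟩

/-- If `offStars` is covered by two disjoint open sets, then some separation in the tangle points
to only one of them. -/
theorem IsTangle.exists_offStars_subset (hτ : IsTangle G τ)
    {ε : V → G.edgeSet → Set.Ioc (0 : ℝ) 1} {s : Set V × Set V} (hs : s ∈ τ) {Y : Set V}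
    (hY : Y.Finite) (hsY : s.1 ∩ s.2 ⊆ Y) {O₁ O₂ : Set (OneComplex r)} (h₁ : IsOpen O₁)
    (h₂ : IsOpen O₂) (hdis : Disjoint O₁ O₂) (hcov : offStars r ε Y s.2 ⊆ O₁ ∪ O₂) :
    ∃ t ∈ τ, offStars r ε Y t.2 ⊆ O₁ ∨ offStars r ε Y t.2 ⊆ O₂ := by
  have hd : ∀ x, x ∈ O₁ → x ∉ O₂ := fun _ h h' =>
    Set.disjoint_left.1 hdis h h'
  -- the two classes of vertices
  set B₁ : Set V := {v | v ∈ s.2 ∧ v ∉ Y ∧ OneComplex.vertex v ∈ O₁} with hB₁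
  set B₂ : Set V := {v | v ∈ s.2 ∧ v ∉ Y ∧ OneComplex.vertex v ∈ O₂} with hB₂
  have hedge : ∀ e : G.edgeSet, r.src e ∈ s.2 → r.tgt e ∈ s.2 →
      ¬ (r.src e ∈ Y ∧ r.tgt e ∈ Y) → _ := fun e hse hte hn =>
    edge_subset_of_cover h₁ h₂ hdis hcov hse hte hn
  -- The part of an edge off the stars lies wholly in `O₁` or wholly in `O₂`, so an end outside `Y`
  -- decides which.
  have hends : ∀ e : G.edgeSet, r.src e ∈ s.2 → r.tgt e ∈ s.2 →
      (r.src e ∈ B₁ ∨ r.tgt e ∈ B₁ →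
        ∀ t, glue r ⟨e, t⟩ ∈ offStars r ε Y s.2 → glue r ⟨e, t⟩ ∈ O₁) ∧
      (r.src e ∈ B₂ ∨ r.tgt e ∈ B₂ →
        ∀ t, glue r ⟨e, t⟩ ∈ offStars r ε Y s.2 → glue r ⟨e, t⟩ ∈ O₂) := by
    intro e hse hte
    refine ⟨fun h => ?_, fun h => ?_⟩
    · have hn : ¬ (r.src e ∈ Y ∧ r.tgt e ∈ Y) := fun hn =>
        h.elim (fun h => h.2.1 hn.1) fun h => h.2.1 hn.2
      refine (hedge e hse hte hn).resolve_right fun hall => ?_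
      rcases h with h | h
      · have := hall 0 (by rw [glue_zero]; exact vertex_mem_offStars hse h.2.1)
        rw [glue_zero] at this
        exact hd _ h.2.2 this
      · have := hall 1 (by rw [glue_one]; exact vertex_mem_offStars hte h.2.1)
        rw [glue_one] at this
        exact hd _ h.2.2 this
    · have hn : ¬ (r.src e ∈ Y ∧ r.tgt e ∈ Y) := fun hn =>
        h.elim (fun h => h.2.1 hn.1) fun h => h.2.1 hn.2
      refine (hedge e hse hte hn).resolve_left fun hall => ?_
      rcases h with h | h
      · have := hall 0 (by rw [glue_zero]; exact vertex_mem_offStars hse h.2.1)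
        rw [glue_zero] at this
        exact hd _ this h.2.2
      · have := hall 1 (by rw [glue_one]; exact vertex_mem_offStars hte h.2.1)
        rw [glue_one] at this
        exact hd _ this h.2.2
  have hadj : ∀ a ∈ B₁, ∀ b ∈ B₂, ¬ G.Adj a b := by
    intro a ha b hb hab
    obtain ⟨e, he⟩ : ∃ e : G.edgeSet, (e : Sym2 V) = s(a, b) := ⟨⟨s(a, b), hab⟩, rfl⟩
    have hends' := r.edge_eq e
    rw [he, Sym2.eq_iff] at hends'
    rcases hends' with ⟨h0, h1⟩ | ⟨h0, h1⟩
    · have hm : glue r ⟨e, 0⟩ ∈ offStars r ε Y s.2 := by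
        rw [glue_zero, h0]
        exact vertex_mem_offStars ha.1 ha.2.1
      have := hends e (h0 ▸ ha.1) (h1 ▸ hb.1)
      exact hd _ (this.1 (Or.inl (h0 ▸ ha)) 0 hm) (this.2 (Or.inr (h1 ▸ hb)) 0 hm)
    · have hm : glue r ⟨e, 0⟩ ∈ offStars r ε Y s.2 := by
        rw [glue_zero, h0]
        exact vertex_mem_offStars hb.1 hb.2.1
      have := hends e (h0 ▸ hb.1) (h1 ▸ ha.1)
      exact hd _ (this.1 (Or.inr (h1 ▸ ha)) 0 hm) (this.2 (Or.inl (h0 ▸ hb)) 0 hm)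
  obtain ⟨t, ht, hts, hcase⟩ := hτ.exists_mem_of_cover hs hY hsY (B₁ := B₁) (B₂ := B₂) (by
      intro v hv
      by_cases hvY : v ∈ Y
      · exact Or.inl (Or.inl hvY)
      · rcases hcov (vertex_mem_offStars hv hvY) with h | h
        · exact Or.inl (Or.inr ⟨hv, hvY, h⟩)
        · exact Or.inr ⟨hv, hvY, h⟩) (fun v hv => hv.1)
    (Set.disjoint_left.2 fun v hv hv' => hd _ hv.2.2 hv'.2.2) hadj
  refine ⟨t, ht, hcase.imp (fun hc => ?_) (fun hc => ?_)⟩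
  -- A vertex of `offStars r ε Y t.2` is outside `Y` and hence in the chosen class; an inner point
  -- lies on an edge with at least one such end.
  all_goals
    rintro (v | ⟨e, p⟩) hx
    · exact ((hc hx.1).resolve_left hx.2.1).2.2
    · have hx' := offStars_mono subset_rfl hts hx
      have hor := (not_and_or.1 hx.2.1).imp (hc hx.1.1).resolve_left (hc hx.1.2).resolve_left
      have := hends e (hts hx.1.1) (hts hx.1.2)
      rw [inner_eq_glue] at hx' ⊢
      first
      | exact this.1 hor _ hx'
      | exact this.2 hor _ hx'

/-- The points that `τ` points to and that avoid the `ε`-stars around all the vertices. -/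
def starCore (r : Representation G) (τ : Set (Set V × Set V))
    (ε : V → G.edgeSet → Set.Ioc (0 : ℝ) 1) : Set (StoneCech (OneComplex r)) :=
  ⋂ i : τ × Finset V, closure (stoneCechUnit '' offStars r ε i.2 i.1.1.2)

/-- Taking `Y = {v}` excludes the vertex `v`, taking `Y` to be the two ends of `e` excludes the
inner points of `e`, and `Y = ∅` gives the closures of the big sides. -/
theorem starCore_subset (hτ : IsTangle G τ) (ε : V → G.edgeSet → Set.Ioc (0 : ℝ) 1) :
    starCore r τ ε ⊆ tangleRemainder r τ := by
  classical
  intro z hz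
  have hz' : ∀ s ∈ τ, ∀ Y : Finset V, z ∈ closure (stoneCechUnit '' offStars r ε Y s.2) :=
    fun s hs Y => Set.mem_iInter.1 hz (⟨s, hs⟩, Y)
  obtain ⟨s₀, hs₀⟩ := hτ.nonempty
  refine ⟨mem_remainder_of (fun v => ⟨ε v, ?_⟩) (fun e => ?_), fun s hs => ?_⟩
  · refine closure_mono (Set.image_mono ?_) (hz' s₀ hs₀ {v})
    exact fun x hx => hx.2.2 v (by simp)
  · refine closure_mono (Set.image_mono ?_) (hz' s₀ hs₀ {r.src e, r.tgt e})
    rintro x hx t rfl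
    exact hx.2.1 ⟨by simp, by simp⟩
  · exact closure_mono (Set.image_mono fun x hx => hx.1) (hz' s hs ∅)

/-- Off `offStars`, the complex `G[B]` is covered by the compact `G[Y]` and finitely many stars. As
`Y` is finite, closure commutes with this union, and `z` avoids each piece. -/
theorem mem_starCore {ε : V → G.edgeSet → Set.Ioc (0 : ℝ) 1} {z : StoneCech (OneComplex r)}
    (hz : z ∈ tangleRemainder r τ)
    (hε : ∀ v, z ∉ closure (stoneCechUnit '' {x | starFn r v (ε v) x ≠ 1})) :
    z ∈ starCore r τ ε := by
  refine Set.mem_iInter.2 fun ⟨⟨s, hs⟩, Y⟩ => ?_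
  have h1 := hz.2 s hs
  have hsub : inducedComplex r s.2 ⊆ offStars r ε Y s.2 ∪ (inducedComplex r Y ∪
      ⋃ v ∈ Y, {x | starFn r v (ε v) x ≠ 1}) := by
    intro x hx
    by_contra hn
    simp only [Set.mem_union, Set.mem_iUnion, not_or, exists_prop, not_exists, not_and,
      Set.mem_ofPred_eq, not_not] at hn
    exact hn.1 ⟨hx, hn.2.1, fun v hv => hn.2.2 v hv⟩
  have h2 := closure_mono (Set.image_mono (f := stoneCechUnit) hsub) h1
  rw [Set.image_union, closure_union, Set.image_union, closure_union] at h2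
  refine h2.resolve_right fun h => h.elim
    (notMem_closure_induced hz.1 Y.finite_toSet) fun h => ?_
  rw [Set.image_iUnion₂] at h
  have h3 : closure (⋃ v ∈ Y, stoneCechUnit '' {x | starFn r v (ε v) x ≠ 1}) =
      ⋃ v ∈ Y, closure (stoneCechUnit '' {x | starFn r v (ε v) x ≠ 1}) :=
    Finset.closure_biUnion Y _
  rw [h3] at h
  simp only [Set.mem_iUnion, exists_prop] at h
  obtain ⟨v, -, hv⟩ := h
  exact hε v hv

theorem isPreconnected_starCore (hτ : IsTangle G τ) (ε : V → G.edgeSet → Set.Ioc (0 : ℝ) 1) :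
    IsPreconnected (starCore r τ ε) := by
  classical
  have hclosed : IsClosed (starCore r τ ε) := isClosed_iInter fun _ => isClosed_closure
  rw [isPreconnected_iff_subset_of_fully_disjoint_closed hclosed]
  intro u v hu hv huv hdis
  obtain ⟨O₁, O₂, hO₁, hO₂, hu₁, hv₂, hOO⟩ := normal_separation hu hv hdis
  have hdir : Directed (· ⊇ ·) fun i : τ × Finset V =>
      closure (stoneCechUnit '' offStars r ε i.2 i.1.1.2) := by
    rintro ⟨⟨s, hs⟩, Y⟩ ⟨⟨t, ht⟩, Z⟩
    refine ⟨⟨⟨_, hτ.join_mem hs ht⟩, Y ∪ Z⟩, ?_, ?_⟩ <;>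
      refine closure_mono (Set.image_mono (offStars_mono ?_ ?_))
    · simp
    · exact Set.inter_subset_left
    · simp
    · exact Set.inter_subset_right
  have : Nonempty (τ × Finset V) := by
    obtain ⟨s, hs⟩ := hτ.nonempty
    exact ⟨⟨s, hs⟩, ∅⟩
  -- Compactness moves the splitting from the intersection to a single member of the directed
  -- family; `Y` is then enlarged to contain the separator of `s`.
  obtain ⟨⟨⟨s, hs⟩, Y⟩, hsY⟩ := exists_subset_nhds_of_isCompact hdir
    (fun _ => isClosed_closure.isCompact) (U := O₁ ∪ O₂) fun x hx =>
      (hO₁.union hO₂).mem_nhds ((huv hx).imp (@hu₁ x) (@hv₂ x))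
  have hfin := (hτ.isSeparation hs).2.1
  set Z : Finset V := Y ∪ hfin.toFinset with hZ
  have hcov : offStars r ε Z s.2 ⊆ stoneCechUnit ⁻¹' O₁ ∪ stoneCechUnit ⁻¹' O₂ := fun x hx =>
    hsY (subset_closure ⟨x, offStars_mono (by simp [hZ]) subset_rfl hx, rfl⟩)
  obtain ⟨t, ht, hcase⟩ := hτ.exists_offStars_subset hs Z.finite_toSet (by simp [hZ])
    (hO₁.preimage continuous_stoneCechUnit) (hO₂.preimage continuous_stoneCechUnit)
    (hOO.preimage _) hcov
  have hsubt : starCore r τ ε ⊆ closure (stoneCechUnit '' offStars r ε Z t.2) :=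
    Set.iInter_subset _ ((⟨t, ht⟩, Z) : τ × Finset V)
  rcases hcase with h | h
  · left
    intro p hp
    refine (huv hp).resolve_right fun hpv => ?_
    obtain ⟨_, hq, x, hx, rfl⟩ := mem_closure_iff.1 (hsubt hp) O₂ hO₂ (hv₂ hpv)
    exact Set.disjoint_left.1 hOO (h hx) hq
  · right
    intro p hp
    refine (huv hp).resolve_left fun hpu => ?_
    obtain ⟨_, hq, x, hx, rfl⟩ := mem_closure_iff.1 (hsubt hp) O₁ hO₁ (hu₁ hpu)
    exact Set.disjoint_left.1 hOO hq (h hx)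

theorem starFn_eq_one_of_le {v : V} {ε ε' : G.edgeSet → Set.Ioc (0 : ℝ) 1} (h : ∀ e, ε' e ≤ ε e)
    {x : OneComplex r} (hx : starFn r v ε x = 1) : starFn r v ε' x = 1 := by
  rcases x with w | ⟨e, t⟩
  · by_cases hw : w = v
    · subst hw
      rw [starFn_vertex_self] at hx
      exact absurd hx zero_ne_one
    · exact starFn_vertex_of_ne hw
  · rw [inner_eq_glue, starFn_glue] at hx ⊢
    have he : (ε' e : ℝ) ≤ ε e := h e
    by_cases hs : r.src e = v
    · rw [starEdge_eq_one_of_src hs] at hx ⊢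
      exact he.trans hx
    · by_cases ht : r.tgt e = v
      · rw [starEdge_eq_one_of_tgt ht] at hx ⊢
        exact he.trans hx
      · exact starEdge_of_ne hs ht _

theorem starFn_ne_one_subset {v : V} {ε ε' : G.edgeSet → Set.Ioc (0 : ℝ) 1}
    (h : ∀ e, ε' e ≤ ε e) :
    {x : OneComplex r | starFn r v ε' x ≠ 1} ⊆ {x | starFn r v ε x ≠ 1} :=
  fun _ hx hx' => hx (starFn_eq_one_of_le h hx')

/-- Each point comes with star radii avoiding it. The minimum of the radii for two points gives one
connected `starCore` containing both. -/
theorem isPreconnected_tangleRemainder (hτ : IsTangle G τ) :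
    IsPreconnected (tangleRemainder r τ) := by
  refine isPreconnected_of_forall_pair fun x hx y hy => ?_
  have hsep : ∀ z ∈ tangleRemainder r τ, ∃ ε : V → G.edgeSet → Set.Ioc (0 : ℝ) 1,
      ∀ v, z ∉ closure (stoneCechUnit '' {x | starFn r v (ε v) x ≠ 1}) := by
    intro z hz
    have : ∀ v, ∃ ε, z ∉ closure (stoneCechUnit '' {x | starFn r v ε x ≠ 1}) := fun v =>
      exists_starFn_separating fun h => hz.1 ⟨_, h.symm⟩
    choose ε hε using this
    exact ⟨ε, hε⟩
  obtain ⟨ε, hε⟩ := hsep x hx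
  obtain ⟨δ, hδ⟩ := hsep y hy
  refine ⟨starCore r τ fun v e => min (ε v e) (δ v e), starCore_subset hτ _,
    mem_starCore hx fun v h => hε v ?_, mem_starCore hy fun v h => hδ v ?_,
    isPreconnected_starCore hτ _⟩
  · exact closure_mono (Set.image_mono (starFn_ne_one_subset fun e => min_le_left _ _)) h
  · exact closure_mono (Set.image_mono (starFn_ne_one_subset fun e => min_le_right _ _)) h

end TangleRemainder

/-! # Ultrafilters along a tangle -/

section Limits

variable {G : SimpleGraph V} {τ : Set (Set V × Set V)} {r : Representation G}

open Filter Topology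

/-- Joins in `τ` make the filters `cofinite ⊓ 𝓟 (T s)` directed, so their infimum is proper. This
serves both for vertices in big sides and for edges at a core vertex. -/
theorem IsTangle.exists_ultrafilter {α : Type*} (hτ : IsTangle G τ) (T : Set V × Set V → Set α)
    (hinf : ∀ s ∈ τ, (T s).Infinite) (hanti : ∀ s t, SepLE s t → T t ⊆ T s) :
    ∃ U : Ultrafilter α, (∀ s ∈ τ, T s ∈ U) ∧ (U : Filter α) ≤ cofinite := by
  have : Nonempty τ := hτ.nonempty.to_subtype
  have hne : (⨅ s : τ, cofinite ⊓ 𝓟 (T s)).NeBot := by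
    refine iInf_neBot_of_directed' ?_ fun s => cofinite_inf_principal_neBot_iff.2 (hinf s s.2)
    rintro ⟨s, hs⟩ ⟨t, ht⟩
    refine ⟨⟨_, hτ.join_mem hs ht⟩, ?_, ?_⟩ <;>
      refine inf_le_inf_left _ (principal_mono.2 (hanti _ _ ?_))
    exacts [⟨Set.subset_union_left, Set.inter_subset_left⟩,
      ⟨Set.subset_union_right, Set.inter_subset_right⟩]
  have hle := Ultrafilter.of_le (⨅ s : τ, cofinite ⊓ 𝓟 (T s))
  refine ⟨Ultrafilter.of (⨅ s : τ, cofinite ⊓ 𝓟 (T s)), fun s hs => ?_, ?_⟩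
  · exact hle (mem_iInf_of_mem ⟨s, hs⟩ (mem_inf_of_right (mem_principal_self _)))
  · obtain ⟨s⟩ := this
    exact hle.trans ((iInf_le _ s).trans inf_le_left)

/-- Take a limit of vertices along a free ultrafilter containing all big sides: the star of radius
`1` around `v` contains no other vertex, and no vertex is an inner edge point. -/
theorem nonempty_tangleRemainder (hτ : IsTangle G τ) : (tangleRemainder r τ).Nonempty := by
  obtain ⟨U, hU, hfree⟩ := hτ.exists_ultrafilter (fun s => s.2) (fun s hs => hτ.infinite_snd hs)
    fun s t h => h.2
  have hlim : Tendsto (vertexPt r) U (𝓝 (U.map (vertexPt r)).lim) :=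
    Ultrafilter.le_nhds_lim (U.map (vertexPt r))
  refine ⟨(U.map (vertexPt r)).lim, mem_remainder_of (fun v => ?_) (fun e => ?_), fun s hs => ?_⟩
  · refine ⟨fun _ => ⟨1, by simp⟩, mem_closure_of_tendsto hlim ?_⟩
    have : {v}ᶜ ∈ (U : Filter V) := hfree (Set.finite_singleton v).compl_mem_cofinite
    filter_upwards [this] with w hw
    exact ⟨_, starFn_vertex_of_ne hw, rfl⟩
  · exact mem_closure_of_tendsto hlim (Eventually.of_forall fun w => ⟨.vertex w, by simp, rfl⟩)
  · refine mem_closure_of_tendsto hlim ?_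
    filter_upwards [hU s hs] with w hw
    exact ⟨.vertex w, hw, rfl⟩

/-! # The intervals `𝕀_U` -/

variable {U : Ultrafilter G.edgeSet}

theorem tendsto_limitPt (U : Ultrafilter G.edgeSet) (t : unitInterval) :
    Tendsto (fun e => (stoneCechUnit (⟨e, t⟩ : EdgeSum G))) U (𝓝 (limitPt U t)) :=
  Ultrafilter.le_nhds_lim (U.map fun e => stoneCechUnit (⟨e, t⟩ : EdgeSum G))

theorem ne_of_separating {Y : Type*} [TopologicalSpace Y] {f : Y → unitInterval}
    (hf : Continuous f) {S T : Set Y} (hS : ∀ x ∈ S, f x = 0) (hT : ∀ x ∈ T, f x = 1)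
    {p q : StoneCech Y} (hp : p ∈ closure (stoneCechUnit '' S))
    (hq : q ∈ closure (stoneCechUnit '' T)) : p ≠ q := by
  rintro rfl
  have h0 : stoneCechExtend hf p = 0 := stoneCechExtend_mem hf isClosed_singleton hS hp
  have h1 : stoneCechExtend hf p = 1 := stoneCechExtend_mem hf isClosed_singleton hT hq
  exact zero_ne_one (h0.symm.trans h1)

theorem continuous_unit_edge (e : G.edgeSet) :
    Continuous fun t : unitInterval => stoneCechUnit (⟨e, t⟩ : EdgeSum G) :=
  continuous_stoneCechUnit.comp
    (continuous_sigmaMk (σ := fun _ : G.edgeSet => unitInterval) (i := e))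

/-- In a closed neighbourhood of `a_U`, pick for almost every edge an inner point near `a_e`. The
limit of these points stays in the neighbourhood and in `𝕀_U`, and rescaling each edge around its
chosen point separates it from both ends. -/
theorem limitPt_mem_closure_limitInterior (U : Ultrafilter G.edgeSet) (a : unitInterval) :
    limitPt U a ∈ closure (limitInterior U) := by
  rw [mem_closure_iff_nhds_basis (closed_nhds_basis _)]
  rintro N ⟨hN, hNc⟩
  have hdense : ∀ t : unitInterval, t ∈ closure (Set.Ioo (0 : unitInterval) 1) := fun t => by
    rw [closure_Ioo zero_ne_one]
    exact ⟨t.2.1, t.2.2⟩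
  have hopen : ∀ e : G.edgeSet,
      IsOpen {t : unitInterval | stoneCechUnit (⟨e, t⟩ : EdgeSum G) ∈ interior N} := fun e =>
    isOpen_interior.preimage (continuous_unit_edge e)
  have hex : ∀ e : G.edgeSet, ∃ t ∈ Set.Ioo (0 : unitInterval) 1,
      stoneCechUnit (⟨e, a⟩ : EdgeSum G) ∈ interior N →
        stoneCechUnit (⟨e, t⟩ : EdgeSum G) ∈ N := by
    intro e
    by_cases he : stoneCechUnit (⟨e, a⟩ : EdgeSum G) ∈ interior N
    · obtain ⟨t, ht, hI⟩ := mem_closure_iff.1 (hdense a)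
        _ (hopen e) he
      exact ⟨t, hI, fun _ => interior_subset ht⟩
    · obtain ⟨t, -, hI⟩ := mem_closure_iff.1 (hdense a) _ isOpen_univ trivial
      exact ⟨t, hI, fun h => absurd h he⟩
  choose t ht hN' using hex
  set g : G.edgeSet → StoneCech (EdgeSum G) := fun e => stoneCechUnit ⟨e, t e⟩ with hg
  have hlim : Tendsto g U (𝓝 (U.map g).lim) := Ultrafilter.le_nhds_lim (U.map g)
  -- the distance to `t e`, scaled so that it is at least `1` at both ends
  let F : EdgeSum G → unitInterval := fun y => Set.projIcc 0 1 zero_le_one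
    (|(y.2 : ℝ) - t y.1| / min (t y.1 : ℝ) (1 - t y.1))
  have hF : Continuous F := by
    rw [continuous_sigma_iff]
    intro e
    have hc : Continuous fun y : unitInterval => |(y : ℝ) - t e| := by fun_prop
    exact continuous_projIcc.comp (hc.div_const (min (t e : ℝ) (1 - t e)))
  have hpos : ∀ e, 0 < min (t e : ℝ) (1 - t e) := fun e =>
    lt_min (ht e).1 (sub_pos.2 (ht e).2)
  have hF0 : ∀ x ∈ Set.range fun e => (⟨e, t e⟩ : EdgeSum G), F x = 0 := by
    rintro _ ⟨e, rfl⟩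
    simp [F, Set.projIcc_left]
  have hF1 : ∀ b : unitInterval, b = 0 ∨ b = 1 →
      ∀ x ∈ Set.range fun e => (⟨e, b⟩ : EdgeSum G), F x = 1 := by
    rintro b hb _ ⟨e, rfl⟩
    simp only [F, projIcc_eq_one_iff]
    rw [one_le_div (hpos e)]
    rcases hb with rfl | rfl
    · simpa using Or.inl (le_abs_self _)
    · exact (min_le_right _ _).trans (le_abs_self _)
  have hne : ∀ b : unitInterval, b = 0 ∨ b = 1 → (U.map g).lim ≠ limitPt U b := fun b hb =>
    ne_of_separating hF hF0 (hF1 b hb)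
      (mem_closure_of_tendsto hlim (Eventually.of_forall fun e => ⟨_, ⟨e, rfl⟩, rfl⟩))
      (mem_closure_of_tendsto (tendsto_limitPt U b)
        (Eventually.of_forall fun e => ⟨_, ⟨e, rfl⟩, rfl⟩))
  refine ⟨(U.map g).lim, ⟨?_, ?_⟩, ?_⟩
  · refine Set.mem_iInter₂.2 fun J hJ => mem_closure_of_tendsto hlim ?_
    filter_upwards [hJ] with e he
    exact ⟨_, he, rfl⟩
  · rintro (h | h)
    exacts [hne 0 (Or.inl rfl) h, hne 1 (Or.inr rfl) h]
  · refine hNc.closure_eq ▸ mem_closure_of_tendsto hlim ?_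
    filter_upwards [(tendsto_limitPt U a) (interior_mem_nhds.2 hN)] with e he
    exact hN' e he

theorem continuous_betaGlue : Continuous (betaGlue r) := continuous_stoneCechExtend _

theorem betaGlue_unit (y : EdgeSum G) :
    betaGlue r (stoneCechUnit y) = stoneCechUnit (glue r y) :=
  stoneCechExtend_stoneCechUnit _ y

theorem betaGlue_mem_closure {S : Set (EdgeSum G)} {T : Set (OneComplex r)}
    (hST : ∀ y ∈ S, glue r y ∈ T) {p : StoneCech (EdgeSum G)}
    (hp : p ∈ closure (stoneCechUnit '' S)) : betaGlue r p ∈ closure (stoneCechUnit '' T) := by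
  have : closure (stoneCechUnit '' S) ⊆ betaGlue r ⁻¹' closure (stoneCechUnit '' T) := by
    refine closure_minimal ?_ (isClosed_closure.preimage continuous_betaGlue)
    rintro _ ⟨y, hy, rfl⟩
    rw [Set.mem_preimage, betaGlue_unit]
    exact subset_closure ⟨_, hST y hy, rfl⟩
  exact this hp

theorem ends_of_glue_eq_vertex {e : G.edgeSet} {a : unitInterval} {x : V}
    (h : glue r ⟨e, a⟩ = .vertex x) : (r.src e = x ∧ a = 0) ∨ (r.tgt e = x ∧ a = 1) := by
  rcases glue_cases r e a with ⟨ha, h'⟩ | ⟨ha, h'⟩ | ⟨t, h', -⟩ <;> rw [h'] at h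
  · exact Or.inl ⟨OneComplex.vertex.inj h, ha⟩
  · exact Or.inr ⟨OneComplex.vertex.inj h, ha⟩
  · cases h

theorem betaGlue_limitPt {a : unitInterval} {x : V}
    (hx : ∀ᶠ e in (U : Filter G.edgeSet), glue r ⟨e, a⟩ = .vertex x) :
    betaGlue r (limitPt U a) = vertexPt r x := by
  have h1 := (continuous_betaGlue (r := r)).continuousAt.tendsto.comp (tendsto_limitPt U a)
  refine tendsto_nhds_unique h1 (tendsto_const_nhds.congr' ?_)
  filter_upwards [hx] with e he
  simp only [Function.comp_apply, betaGlue_unit, he]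
  rfl

/-- If almost all edges have the vertex `x` as their end `a`, then a point of `𝕀_U` other than `a_U`
is not mapped near `x`. -/
theorem exists_starFn_of_ne_limitPt {a : unitInterval} {x : V}
    (hx : ∀ᶠ e in (U : Filter G.edgeSet), glue r ⟨e, a⟩ = .vertex x)
    {p : StoneCech (EdgeSum G)} (hp : p ∈ limitInterval U) (hpa : p ≠ limitPt U a) :
    ∃ ε, betaGlue r p ∈ closure (stoneCechUnit '' {y | starFn r x ε y = 1}) := by
  obtain ⟨M, N, hM, hN, hpM, haN, hMN⟩ := t2_separation hpa
  -- The condition is vacuous on edges whose point `a` is outside `N` or not glued to `x`, so a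
  -- radius can be chosen on every edge.
  have hex : ∀ e, _ := fun e => exists_radius (r := r) (e := e) (v := x)
    (P := fun t => stoneCechUnit (⟨e, a⟩ : EdgeSum G) ∈ N ∧ glue r ⟨e, a⟩ = .vertex x →
      stoneCechUnit (⟨e, t⟩ : EdgeSum G) ∈ N) (by
        by_cases h : stoneCechUnit (⟨e, a⟩ : EdgeSum G) ∈ N ∧ glue r ⟨e, a⟩ = .vertex x
        · simp only [h, and_self, forall_const]
          exact hN.preimage (continuous_unit_edge e)
        · simp [h])
    (fun hs h => by
      rcases ends_of_glue_eq_vertex h.2 with ⟨-, rfl⟩ | ⟨ht, -⟩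
      exacts [h.1, absurd (hs.trans ht.symm) (r.src_ne_tgt e)])
    (fun ht h => by
      rcases ends_of_glue_eq_vertex h.2 with ⟨hs, -⟩ | ⟨-, rfl⟩
      exacts [absurd (hs.trans ht.symm) (r.src_ne_tgt e), h.1])
  choose ε hε using hex
  refine ⟨ε, ?_⟩
  set J : Set G.edgeSet :=
    {e | stoneCechUnit (⟨e, a⟩ : EdgeSum G) ∈ N ∧ glue r ⟨e, a⟩ = .vertex x} with hJ
  have hJU : J ∈ U := Filter.inter_mem ((tendsto_limitPt U a) (hN.mem_nhds haN)) hx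
  -- Near `p` only points in `M`, hence outside `N`, matter; on edges of `J` these are off the star,
  -- whose points map into `N`.
  have hp' : p ∈ closure (stoneCechUnit '' {y : EdgeSum G | y.1 ∈ J ∧ stoneCechUnit y ∉ N}) := by
    rw [mem_closure_iff]
    intro O hO hpO
    obtain ⟨_, hy, y, hyJ, rfl⟩ := mem_closure_iff.1 (Set.mem_iInter₂.1 hp J hJU) (O ∩ M)
      (hO.inter hM) ⟨hpO, hpM⟩
    exact ⟨_, hy.1, y, ⟨hyJ, Set.disjoint_left.1 hMN hy.2⟩, rfl⟩
  refine betaGlue_mem_closure ?_ hp'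
  rintro ⟨e, t⟩ ⟨heJ, hyN⟩
  rw [Set.mem_ofPred_eq, starFn_glue]
  rcases ends_of_glue_eq_vertex heJ.2 with ⟨hs, -⟩ | ⟨ht, -⟩
  · rw [starEdge_eq_one_of_src hs]
    by_contra! hlt
    exact hyN ((hε e t).1 hs hlt heJ)
  · rw [starEdge_eq_one_of_tgt ht]
    by_contra! hlt
    exact hyN ((hε e t).2 ht hlt heJ)

theorem betaGlue_limitInterior_subset {a : unitInterval} (ha : a = 0 ∨ a = 1) {x : V}
    (hfree : (U : Filter G.edgeSet) ≤ cofinite)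
    (hU : ∀ s ∈ τ, {e | r.src e ∈ s.2 ∧ r.tgt e ∈ s.2} ∈ U)
    (hx : ∀ᶠ e in (U : Filter G.edgeSet), glue r ⟨e, a⟩ = .vertex x) :
    betaGlue r '' limitInterior U ⊆ tangleRemainder r τ := by
  rintro _ ⟨p, ⟨hp, hpne⟩, rfl⟩
  have hJ : ∀ J ∈ U, p ∈ closure (stoneCechUnit '' {y : EdgeSum G | y.1 ∈ J}) :=
    fun J hJ => Set.mem_iInter₂.1 hp J hJ
  refine ⟨mem_remainder_of (fun v => ?_) (fun e => ?_), fun s hs => ?_⟩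
  · by_cases hv : v = x
    · subst hv
      refine exists_starFn_of_ne_limitPt hx hp fun h => hpne ?_
      rcases ha with rfl | rfl
      exacts [Or.inl h, Or.inr h]
    · refine ⟨fun _ => ⟨1, by simp⟩, ?_⟩
      -- At most one edge joins `x` to `v`, so almost every edge at `x` misses `v` and the constant
      -- radius `1` works.
      have hfin : {e : G.edgeSet | (e : Sym2 V) = s(x, v)}.Finite :=
        (Set.finite_singleton (s(x, v))).preimage Subtype.val_injective.injOn
      refine betaGlue_mem_closure ?_
        (hJ _ (Filter.inter_mem hx (hfree hfin.compl_mem_cofinite)))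
      rintro ⟨e, t⟩ ⟨he, hne⟩
      rw [Set.mem_ofPred_eq, starFn_glue]
      have hne' : ¬ s(r.src e, r.tgt e) = s(x, v) := by
        rw [r.edge_eq e]
        exact hne
      rw [Sym2.eq_iff] at hne'
      have hv' : x ≠ v := fun h => hv h.symm
      rcases ends_of_glue_eq_vertex he with ⟨h, -⟩ | ⟨h, -⟩
      · exact starEdge_of_ne (h ▸ hv') (fun h' => hne' (Or.inl ⟨h, h'⟩)) t
      · exact starEdge_of_ne (fun h' => hne' (Or.inr ⟨h', h⟩)) (h ▸ hv') t
  · refine betaGlue_mem_closure ?_ (hJ _ (hfree (Set.finite_singleton e).compl_mem_cofinite))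
    rintro ⟨e', t⟩ he' t' h
    rcases glue_cases r e' t with ⟨-, h'⟩ | ⟨-, h'⟩ | ⟨t'', h', -⟩ <;> rw [h'] at h
    · cases h
    · cases h
    · cases h
      exact he' rfl
  · exact betaGlue_mem_closure (fun y hy => glue_mem_induced hy.1 hy.2 y.2) (hJ _ (hU s hs))

theorem isReachedFrom_of_mem_core (hτ : IsTangle G τ) {x : V} (hx : x ∈ tangleCore τ) :
    IsReachedFrom r (tangleRemainder r τ) x := by
  have hinf : ∀ s ∈ τ, {e : G.edgeSet |
      (r.src e = x ∨ r.tgt e = x) ∧ r.src e ∈ s.2 ∧ r.tgt e ∈ s.2}.Infinite := by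
    intro s hs hfin
    refine hτ.infinite_neighbors hx hs (((hfin.image r.src).union (hfin.image r.tgt)).subset ?_)
    rintro y ⟨hxy, hy⟩
    have hxs := mem_tangleCore.1 hx s hs
    obtain ⟨e, he⟩ : ∃ e : G.edgeSet, (e : Sym2 V) = s(x, y) := ⟨⟨s(x, y), hxy⟩, rfl⟩
    have hends := r.edge_eq e
    rw [he, Sym2.eq_iff] at hends
    rcases hends with ⟨h0, h1⟩ | ⟨h0, h1⟩
    · exact Or.inr ⟨e, ⟨Or.inl h0, h0 ▸ hxs, h1 ▸ hy⟩, h1⟩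
    · exact Or.inl ⟨e, ⟨Or.inr h1, h0 ▸ hy, h1 ▸ hxs⟩, h0⟩
  obtain ⟨U, hU, hfree⟩ := hτ.exists_ultrafilter
    (fun s => {e : G.edgeSet | (r.src e = x ∨ r.tgt e = x) ∧ r.src e ∈ s.2 ∧ r.tgt e ∈ s.2})
    hinf (fun s t h e he => ⟨he.1, h.2 he.2.1, h.2 he.2.2⟩)
  have hU' : ∀ s ∈ τ, {e | r.src e ∈ s.2 ∧ r.tgt e ∈ s.2} ∈ U := fun s hs =>
    Filter.mem_of_superset (hU s hs) fun e he => he.2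
  obtain ⟨s₀, hs₀⟩ := hτ.nonempty
  have hor : ∀ᶠ e in (U : Filter G.edgeSet), r.src e = x ∨ r.tgt e = x :=
    Filter.mem_of_superset (hU s₀ hs₀) fun e he => he.1
  have hpure : ∀ e, U ≠ pure e := by
    rintro e rfl
    have : {e}ᶜ ∈ (pure e : Ultrafilter G.edgeSet) :=
      hfree (Set.finite_singleton e).compl_mem_cofinite
    exact this rfl
  -- The ultrafilter decides whether `x` is the `0`-end or the `1`-end of almost all the edges.
  rcases Ultrafilter.eventually_or.1 hor with h | h
  · have h' : ∀ᶠ e in (U : Filter G.edgeSet), glue r ⟨e, 0⟩ = .vertex x :=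
      h.mono fun e he => by rw [glue_zero, he]
    exact ⟨U, hpure, Or.inl (betaGlue_limitPt h'),
      betaGlue_limitInterior_subset (Or.inl rfl) hfree hU' h'⟩
  · have h' : ∀ᶠ e in (U : Filter G.edgeSet), glue r ⟨e, 1⟩ = .vertex x :=
      h.mono fun e he => by rw [glue_one, he]
    exact ⟨U, hpure, Or.inr (betaGlue_limitPt h'),
      betaGlue_limitInterior_subset (Or.inr rfl) hfree hU' h'⟩

/-- By continuity of `betaGlue`, the endpoints of `𝕀_U`, being limits of its interior, are mapped
into the closure of `K`. -/
theorem vertexPt_mem_closure_of_isReachedFrom {K : Set (StoneCech (OneComplex r))} {x : V}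
    (h : IsReachedFrom r K x) : vertexPt r x ∈ closure K := by
  obtain ⟨U, -, hx, hK⟩ := h
  have key : ∀ a, betaGlue r (limitPt U a) ∈ closure K := fun a =>
    closure_mono hK (image_closure_subset_closure_image continuous_betaGlue
      ⟨_, limitPt_mem_closure_limitInterior U a, rfl⟩)
  rcases hx with hx | hx <;> rw [← hx] <;> exact key _

/-! # The component of the remainder that corresponds to a tangle -/

theorem closure_tangleRemainder (hτ : IsTangle G τ) :
    closure (tangleRemainder r τ) = tangleRemainder r τ ∪ vertexPt r '' tangleCore τ := by
  refine Set.Subset.antisymm ?_ (Set.union_subset subset_closure ?_)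
  · intro p hp
    have hpB : ∀ s ∈ τ, p ∈ closure (stoneCechUnit '' inducedComplex r s.2) := fun s hs =>
      closure_minimal (fun z hz => hz.2 s hs) isClosed_closure hp
    by_cases hpr : p ∈ remainder r
    · exact Or.inl ⟨hpr, hpB⟩
    · obtain ⟨v | ⟨e, t⟩, rfl⟩ := not_not.1 hpr
      · exact Or.inr ⟨v, mem_tangleCore.2 fun s hs => mem_of_vertexPt_mem_closure (hpB s hs), rfl⟩
      · exact absurd (closure_mono (fun z hz => hz.1) hp) (inner_notMem_closure_remainder t)
  · rintro _ ⟨x, hx, rfl⟩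
    exact vertexPt_mem_closure_of_isReachedFrom (isReachedFrom_of_mem_core hτ hx)

theorem disjoint_tangleRemainder (r : Representation G) (τ : Set (Set V × Set V)) (W : Set V) :
    Disjoint (tangleRemainder r τ) (vertexPt r '' W) := by
  rw [Set.disjoint_left]
  rintro _ hz ⟨x, -, rfl⟩
  exact hz.1 ⟨_, rfl⟩

/-- The closures of the two sides cover `βG` and are disjoint within the remainder, so a component
lies in only one of them. -/
theorem connectedComponentIn_remainder_subset {s : Set V × Set V} (hs : IsSeparation G s)
    {z : StoneCech (OneComplex r)} (hz : z ∈ remainder r)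
    (hzs : z ∈ closure (stoneCechUnit '' inducedComplex r s.2)) :
    connectedComponentIn (remainder r) z ⊆
      closure (stoneCechUnit '' inducedComplex r s.2) := by
  have hcov : inducedComplex r s.1 ∪ inducedComplex r s.2 = Set.univ := by
    ext x
    simp only [Set.mem_union, Set.mem_univ, iff_true]
    rcases x with v | ⟨e, t⟩
    exacts [hs.mem_or v, hs.both_mem_or (r.adj e)]
  have hpre := isPreconnected_iff_subset_of_disjoint_closed.1
    (isPreconnected_connectedComponentIn (F := remainder r) (x := z)) _ _
    (isClosed_closure (s := stoneCechUnit '' inducedComplex r s.1))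
    (isClosed_closure (s := stoneCechUnit '' inducedComplex r s.2)) ?_ ?_
  · refine hpre.resolve_left fun h => ?_
    exact closure_inter_closure_subset hs ⟨h (mem_connectedComponentIn hz), hzs⟩ hz
  · rw [← closure_union, ← Set.image_union, hcov, Set.image_univ,
      denseRange_stoneCechUnit.closure_range]
    exact Set.subset_univ _
  · refine Set.eq_empty_of_forall_notMem fun p hp => ?_
    exact closure_inter_closure_subset hs hp.2 (connectedComponentIn_subset _ _ hp.1)

theorem connectedComponentIn_eq_tangleRemainder (hτ : IsTangle G τ)
    {z : StoneCech (OneComplex r)} (hz : z ∈ tangleRemainder r τ) :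
    connectedComponentIn (remainder r) z = tangleRemainder r τ := by
  refine Set.Subset.antisymm (fun p hp => ⟨connectedComponentIn_subset _ _ hp, fun s hs => ?_⟩) ?_
  · exact connectedComponentIn_remainder_subset (hτ.isSeparation hs) hz.1 (hz.2 s hs) hp
  · exact (isPreconnected_tangleRemainder hτ).subset_connectedComponentIn hz fun p hp => hp.1

/-- This gives existence and uniqueness of `τ_*` at once, since a component meeting `tangleRemainder
r τ` equals it. -/
theorem isTangleComponent_iff (hτ : IsTangle G τ) (K : Set (StoneCech (OneComplex r))) :
    IsTangleComponent r τ K ↔ K = tangleRemainder r τ := by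
  constructor
  · rintro ⟨⟨z, hz, rfl⟩, hK⟩
    refine connectedComponentIn_eq_tangleRemainder hτ ⟨hz, fun s hs => ?_⟩
    have hs' := hτ.isSeparation hs
    obtain ⟨𝒞, h𝒞⟩ := hs'.exists_sepTowards_eq (X := (hs'.2.1.toFinset : Set V)) (by simp)
    have := hK _ 𝒞 (show sepTowards G 𝒞 ∈ τ from h𝒞.symm ▸ hs) (mem_connectedComponentIn hz)
    rwa [show (hs'.2.1.toFinset : Set V) ∪ compVerts G 𝒞 = s.2 from congrArg Prod.snd h𝒞] at this
  · rintro rfl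
    obtain ⟨z, hz⟩ := nonempty_tangleRemainder (r := r) hτ
    exact ⟨⟨z, hz.1, (connectedComponentIn_eq_tangleRemainder hτ hz).symm⟩,
      fun X 𝒞 h𝒞 p hp => hp.2 _ h𝒞⟩

end Limits

end TangleSC

open TangleSC in
theorem proposition7p3 {V : Type*} (G : SimpleGraph V) (r : Representation G) :
    (∀ τ : Set (Set V × Set V), IsUltrafilterTangle G τ →
      ∃ (K : Set (StoneCech (OneComplex r))) (X : Finset V),
        (∀ K', IsTangleComponent r τ K' ↔ K' = K) ∧
        IsLeast (freeSets G τ) X ∧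
        closure K = K ∪ vertexPt r '' (X : Set V) ∧
        Disjoint K (vertexPt r '' (X : Set V)) ∧
        ∀ x ∈ X, IsReachedFrom r K x) ∧
    (∀ ω : GraphEnd G,
      ∃ K : Set (StoneCech (OneComplex r)),
        (∀ K', IsTangleComponent r (endTangle ω) K' ↔ K' = K) ∧
        closure K = K ∪ vertexPt r '' dominatingVerts ω ∧
        Disjoint K (vertexPt r '' dominatingVerts ω) ∧
        ∀ x ∈ dominatingVerts ω, IsReachedFrom r K x) := by
  refine ⟨fun τ hτ => ?_, fun ω => ?_⟩
  · obtain ⟨X, hX, hleast⟩ := hτ.exists_least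
    refine ⟨tangleRemainder r τ, X, isTangleComponent_iff hτ.1, hleast, ?_,
      disjoint_tangleRemainder r τ _, fun x hx => isReachedFrom_of_mem_core hτ.1 ?_⟩
    · rw [hX]
      exact closure_tangleRemainder hτ.1
    · rw [← hX]
      exact hx
  · have hτ := isTangle_endTangle ω
    rw [← core_endTangle ω]
    exact ⟨tangleRemainder r (endTangle ω), isTangleComponent_iff hτ, closure_tangleRemainder hτ,
      disjoint_tangleRemainder r _ _, fun x hx => isReachedFrom_of_mem_core hτ hx⟩
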